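/- Let $\mathscr P$ be a finite set of processes. The actions are $p!q$ (executed by $p$: send to $q$) and $p?q$ (executed by $p$: receive from $q$) for $p\neq q$ in $\mathscr P$. A \emph{compositional MSC (cMSC)} over $\mathscr P$ and a finite message set $\mathit{Msg}$ is a tuple $M=(E,\le,\lhd,\lambda,\mu)$, where $E$ is a nonempty, finite or countably infinite set of events, $\le$ is a partial order on $E$, $\lambda$ labels the events with actions, $\mu$ is a partial function $E\to\mathit{Msg}$, and: - for each process $p$, the set $E_p$ of events executed by $p$ is totally ordered by $\le$, and this order is finite or isomorphic to $(\mathbb N,\le)$; - if $e\lhd f$, then $\lambda(e)=p!q$ and $\lambda(f)=q?p$ for some $p\ne q$; if $e\lhd f$ and $e'\lhd f'$ with $e,e'\in E_p$ and $f,f'\in E_q$, then $e\le e'\iff f\le f'$; - $\le$ is the reflexive transitive closure of $\lhd$ together with the direct-successor relations of the orders on the sets $E_p$; - the domain of $\mu$ is the set of unmatched events (those not related by $\lhd$ to any event); - if $e\lhd f$ and $g$ is unmatched, then $\lambda(g)=\lambda(e)$ implies $e<g$, and $\lambda(g)=\lambda(f)$ implies $g<f$. $M$ is an \emph{MSC}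 if no event is unmatched, and is \emph{connected} if the undirected graph $(E,{\le}\cup{\ge})$ is connected. The product (concatenation) of a finite or infinite sequence $M_1,M_2,\dots$ of finite cMSCs is the set of all cMSCs $M$ whose events are the disjoint union of the events of the $M_i$, with the same labels; in which the events of each process are ordered first by the index $i$ and then as in $M_i$; whose relation $\lhd$ contains those of all $M_i$ and otherwise only pairs $(e,f)$ with $e$ in $M_i$, $f$ in $M_j$, $i<j$ and $\mu_i(e)=\mu_j(f)$; and whose unmatched events keep their messages. An \emph{HMSC} over $\mathscr P$ is a tuple $\mathcal H=(S,\iota,\mathit{Msg},R,F,F_\omega)$ with a finite set $S$ of states, an initial state $\iota\in S$, a finite message set $\mathit{Msg}$, a finite set $R$ of transitions $(s,M,s')$ with $s,s'\in S$ and $M$ a finite cMSC, and $F,F_\omega\subseteq S$. Finite paths have at least one transition. A path is accepting if it starts in $\iota$ and either is finite and ends in $F$, or is infinite and visits some state of $F_\omega$ infinitely often. $L(\mathcal H)$ is the set of MSCs that belong to the product of the labels of some accepting path. $\mathcal H$ is \emph{loop-connected} if for every finite path from a state to itself all cMSCs in the product of its labels are connected, and \emph{flat} if, whenever there are finite paths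 from $s$ to $s'$ and from $s'$ to $s$, then $s=s'$. \textbf{Theorem.} For every finite set $\mathscr P$ of at least two processes (in particular for two processes), the following problem is undecidable: given a loop-connected HMSC $\mathcal H$ over $\mathscr P$, is $L(\mathcal H)\neq\emptyset$? Moreover, for three processes the problem is undecidable already when restricted to HMSCs that are both loop-connected and flat. Here undecidable means that no algorithm gives the correct answer on every input satisfying the stated restriction, whatever it does on other inputs (it need not even terminate on them). -/

import Mathlib

/-- Actions of processes in `P`. `send p q` is the action `p!q` (process `p` sends to `q`),
`recv p q` is the action `p?q` (process `p` receives from `q`). -/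
inductive Act (P : Type) : Type
  | send (p q : P) (h : p ≠ q) : Act P
  | recv (p q : P) (h : p ≠ q) : Act P

/-- The process that executes an action. -/
def Act.proc {P : Type} : Act P → P
  | .send p _ _ => p
  | .recv p _ _ => p

/-- The data of a compositional MSC: events, the order `≤`, the matching relation `⊲`
(here `link`), the labeling `λ` and the partial message function `μ`. -/
structure PreCMSC (P Msg : Type) : Type 1 where
  E : Type
  le : E → E → Prop
  link : E → E → Prop
  lab : E → Act P
  mu : E → Option Msg

namespace PreCMSC

variable {P Msg : Type} (M : PreCMSC P Msg)

/-- The process of an event. -/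
def proc (e : M.E) : P := (M.lab e).proc

/-- The strict order `<`. -/
def lt (e f : M.E) : Prop := M.le e f ∧ e ≠ f

/-- The direct-successor relation `→` on the events of the same process. -/
def succ (e f : M.E) : Prop :=
  M.proc e = M.proc f ∧ M.lt e f ∧ ¬ ∃ g, M.proc g = M.proc e ∧ M.lt e g ∧ M.lt g f

/-- `e` is neither a matched send nor a matched receive. -/
def Unmatched (e : M.E) : Prop := ¬ ∃ f, M.link e f ∨ M.link f e

end PreCMSC

/-- Compositional message sequence charts (cMSCs) over processes `P` and messages `Msg`. -/
structure CMSC (P Msg : Type) : Type 1 extends PreCMSC P Msg where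
  nonempty : Nonempty E
  countable : Countable E
  le_refl : ∀ e, le e e
  le_antisymm : ∀ e f, le e f → le f e → e = f
  le_trans : ∀ e f g, le e f → le f g → le e g
  /-- the events of each process are totally ordered … -/
  proc_total : ∀ e f, toPreCMSC.proc e = toPreCMSC.proc f → le e f ∨ le f e
  /-- … and this total order is finite or isomorphic to `(ℕ, ≤)` -/
  proc_order : ∀ p : P,
    Finite {e : E // toPreCMSC.proc e = p} ∨
    Nonempty ((fun e f : {e : E // toPreCMSC.proc e = p} => le e.1 f.1) ≃r
      (fun m n : ℕ => m ≤ n))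
  link_lab : ∀ e f, link e f →
    ∃ (p q : P) (h : p ≠ q), lab e = Act.send p q h ∧ lab f = Act.recv q p h.symm
  /-- the first-in-first-out condition -/
  fifo : ∀ e f e' f', link e f → link e' f' →
    toPreCMSC.proc e = toPreCMSC.proc e' → toPreCMSC.proc f = toPreCMSC.proc f' →
    (le e e' ↔ le f f')
  le_iff : ∀ e f,
    le e f ↔ Relation.ReflTransGen (fun a b => toPreCMSC.succ a b ∨ link a b) e f
  mu_dom : ∀ e, (mu e).isSome = true ↔ toPreCMSC.Unmatched e
  unmatched_send : ∀ e f g, link e f → toPreCMSC.Unmatched g → lab g = lab e →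
    toPreCMSC.lt e g
  unmatched_recv : ∀ e f g, link e f → toPreCMSC.Unmatched g → lab g = lab f →
    toPreCMSC.lt g f

namespace CMSC

variable {P Msg : Type}

/-- A cMSC is an MSC if it has no unmatched event. -/
def IsMSC (M : CMSC P Msg) : Prop := ∀ e, ¬ M.Unmatched e

/-- The undirected graph `(E, ≤ ∪ ≥)` is connected. -/
def IsConnected (M : CMSC P Msg) : Prop := (SimpleGraph.fromRel M.le).Connected

/-- `N` belongs to the product (concatenation, in the order of `I`) of the family `M`.
For `I = Fin n` this is the `n`-fold concatenation `M₁ ∘ ⋯ ∘ Mₙ` (for `n = 1`, it says that `N` is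
a copy of `M₁`; concatenation is associative), for `I = ℕ` it is the infinite product.
The events of `N` are, up to the bijection `φ`, the disjoint union of those of the factors. -/
def IsProduct {I : Type} [LinearOrder I] (M : I → CMSC P Msg) (N : CMSC P Msg) : Prop :=
  ∃ φ : (Σ i, (M i).E) ≃ N.E,
    (∀ x, N.lab (φ x) = (M x.1).lab x.2) ∧
    (∀ x y, N.proc (φ x) = N.proc (φ y) →
      (N.le (φ x) (φ y) ↔ Sigma.Lex (· < ·) (fun i => (M i).le) x y)) ∧
    (∀ i e f, (M i).link e f → N.link (φ ⟨i, e⟩) (φ ⟨i, f⟩)) ∧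
    (∀ x y, N.link (φ x) (φ y) →
      (∃ i e f, x = ⟨i, e⟩ ∧ y = ⟨i, f⟩ ∧ (M i).link e f) ∨
      (x.1 < y.1 ∧ (M x.1).mu x.2 = (M y.1).mu y.2)) ∧
    (∀ x, N.Unmatched (φ x) → N.mu (φ x) = (M x.1).mu x.2)

end CMSC

/-- High-level message sequence charts (HMSCs) over the processes `P`. -/
structure HMSC (P : Type) : Type 1 where
  S : Type
  finite_S : Finite S
  init : S
  Msg : Type
  finite_Msg : Finite Msg
  R : Set (S × CMSC P Msg × S)
  finite_R : R.Finite
  /-- transitions carry finite cMSCs -/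
  finite_label : ∀ t ∈ R, Finite t.2.1.E
  F : Set S
  Fω : Set S

namespace HMSC

variable {P : Type} (H : HMSC P)

/-- Finite paths `s₀ M₁ s₁ … Mₙ sₙ` with `n ≥ 1`. -/
structure FinPath : Type 1 where
  n : ℕ
  pos : 1 ≤ n
  state : Fin (n + 1) → H.S
  label : Fin n → CMSC P H.Msg
  step : ∀ i : Fin n, (state i.castSucc, label i, state i.succ) ∈ H.R

/-- Infinite paths `s₀ M₁ s₁ M₂ s₂ …` (the labels are indexed from `0`). -/
structure InfPath : Type 1 where
  state : ℕ → H.S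
  label : ℕ → CMSC P H.Msg
  step : ∀ i, (state i, label i, state (i + 1)) ∈ H.R

variable {H}

def FinPath.source (ρ : H.FinPath) : H.S := ρ.state 0

def FinPath.target (ρ : H.FinPath) : H.S := ρ.state (Fin.last ρ.n)

/-- The set of cMSCs generated by a finite path. -/
def FinPath.cmscs (ρ : H.FinPath) : Set (CMSC P H.Msg) := {N | CMSC.IsProduct ρ.label N}

def FinPath.Accepting (ρ : H.FinPath) : Prop := ρ.source = H.init ∧ ρ.target ∈ H.F

/-- The set of cMSCs generated by an infinite path. -/
def InfPath.cmscs (ρ : H.InfPath) : Set (CMSC P H.Msg) := {N | CMSC.IsProduct ρ.label N}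

def InfPath.Accepting (ρ : H.InfPath) : Prop :=
  ρ.state 0 = H.init ∧ ∃ s ∈ H.Fω, {i | ρ.state i = s}.Infinite

variable (H)

/-- The language `L(H)`, a set of MSCs. -/
def language : Set (CMSC P H.Msg) :=
  {N | N.IsMSC ∧ ((∃ ρ : H.FinPath, ρ.Accepting ∧ N ∈ ρ.cmscs) ∨
    (∃ ρ : H.InfPath, ρ.Accepting ∧ N ∈ ρ.cmscs))}

def LoopConnected : Prop :=
  ∀ ρ : H.FinPath, ρ.source = ρ.target → ∀ N ∈ ρ.cmscs, N.IsConnected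

/-- `H` has only self-loops. -/
def Flat : Prop :=
  ∀ s s' : H.S, (∃ ρ : H.FinPath, ρ.source = s ∧ ρ.target = s') →
    (∃ ρ : H.FinPath, ρ.source = s' ∧ ρ.target = s) → s = s'

end HMSC

/-! ### HMSCs as inputs of algorithms -/

/-- An action of `k` processes as a piece of finite data: `(true, p, q)` is `p!q` and
`(false, p, q)` is `p?q`. -/
def Act.code {k : ℕ} : Act (Fin k) → Bool × Fin k × Fin k
  | .send p q _ => (true, p, q)
  | .recv p q _ => (false, p, q)

/-- A finite cMSC as finite data: the list of its events, each with its action and its message if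
it is unmatched (the events of each process being listed in their order), and the list of the
matched pairs, an event being referred to by its position in the first list. -/
abbrev CMSCCode (k : ℕ) : Type :=
  List ((Bool × Fin k × Fin k) × Option ℕ) × List (ℕ × ℕ)

/-- `c` describes the cMSC `M`, where `τ` numbers the messages. The order of `M` is not listed in
`c`: it is generated by the process orders and the matched pairs. -/
def CMSCCode.Represents {k m : ℕ} {Msg : Type} (τ : Msg ≃ Fin m) (c : CMSCCode k)
    (M : CMSC (Fin k) Msg) : Prop :=
  ∃ φ : M.E ≃ Fin c.1.length,
    (∀ e, (M.lab e).code = (c.1.get (φ e)).1) ∧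
    (∀ e, (M.mu e).map (fun a => (τ a : ℕ)) = (c.1.get (φ e)).2) ∧
    (∀ e f, M.proc e = M.proc f → (M.le e f ↔ φ e ≤ φ f)) ∧
    (∀ e f, M.link e f ↔ ((φ e : ℕ), (φ f : ℕ)) ∈ c.2)

/-- An HMSC over `k` processes as finite data:
`(number of states, number of messages, initial state, transitions, F, Fω)`. -/
abbrev HMSCCode (k : ℕ) : Type :=
  ℕ × ℕ × ℕ × List (ℕ × CMSCCode k × ℕ) × List ℕ × List ℕ

namespace HMSCCode

variable {k : ℕ} (c : HMSCCode k)

abbrev numStates : ℕ := c.1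
abbrev numMsgs : ℕ := c.2.1
abbrev init : ℕ := c.2.2.1
abbrev trans : List (ℕ × CMSCCode k × ℕ) := c.2.2.2.1
abbrev accFin : List ℕ := c.2.2.2.2.1
abbrev accInf : List ℕ := c.2.2.2.2.2

/-- `c` describes the HMSC `H`; this determines `H` up to isomorphism (and up to duplicate copies
of transitions), and every HMSC over `Fin k` is described by some `c`. -/
def Represents (c : HMSCCode k) (H : HMSC (Fin k)) : Prop :=
  ∃ (σ : H.S ≃ Fin c.numStates) (τ : H.Msg ≃ Fin c.numMsgs),
    (σ H.init : ℕ) = c.init ∧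
    (∀ t ∈ H.R, ∃ u ∈ c.trans,
      (σ t.1 : ℕ) = u.1 ∧ u.2.1.Represents τ t.2.1 ∧ (σ t.2.2 : ℕ) = u.2.2) ∧
    (∀ u ∈ c.trans, ∃ t ∈ H.R,
      (σ t.1 : ℕ) = u.1 ∧ u.2.1.Represents τ t.2.1 ∧ (σ t.2.2 : ℕ) = u.2.2) ∧
    (∀ s, s ∈ H.F ↔ (σ s : ℕ) ∈ c.accFin) ∧
    (∀ s, s ∈ H.Fω ↔ (σ s : ℕ) ∈ c.accInf)

end HMSCCode

/-- Decidability of the problem "given an HMSC `H` over `k` processes that belongs to the class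
`C`, is `L(H)` nonempty?". The algorithm is a partial recursive function, which has to terminate
(with the right answer) only on descriptions of members of `C`. -/
def NonemptinessDecidable (k : ℕ) (C : HMSC (Fin k) → Prop) : Prop :=
  ∃ f : HMSCCode k →. Bool, Partrec f ∧
    ∀ (c : HMSCCode k) (H : HMSC (Fin k)), c.Represents H → C H →
      ∃ b ∈ f c, (b = true ↔ H.language.Nonempty)

/-!
Two processes already suffice, and the HMSCs constructed are flat, so both parts of the theorem
follow from one reduction (`not_nonemptinessDecidable`).

*From HMSCs to queues.* A rule `(u, v)` of a queue system removes the word `u` from the front of a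
queue and appends the word `v` at its end. It is turned into a cMSC (`block`): process `q` receives
the letters of `u` from `p` and process `p` sends the letters of `v` to `q`, all of them unmatched,
so that the channel from `p` to `q` is the queue. In the opposite direction, `q` sends one matched
message to `p`; it connects the two processes, whence every product of such cMSCs is connected
(`isConnected_of_isProduct`). In a product without unmatched events, the first-in-first-out
condition forces the `a`-th letter sent to be matched with the `a`-th letter received, and by the
definition of the product these letters agree and the sending factor comes strictly before the
receiving one. This says exactly that the rules can be applied one after the other, from the empty
queue to the empty queue (`isQueueRun_of_isProduct`, `RunEvent.isProduct_msc`). The HMSC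
`queueHMSC` appends an initial word `w` and then applies rules in self-loops of a single state; its
language is nonempty if and only if the queue with content `w` can be emptied.

*From queues to Turing machines.* With rules that move a letter from the front to the end, the
queue is a cyclic word, on which the other rules act by rewriting a factor. The configuration of a
Turing machine is written as such a cyclic word, with a marker between the two ends of the tape,
and the steps of the machine, as well as the extension of the tape by blanks, are local
rewritings. The state letter occurs exactly once, so that, up to rotation and blanks, the queue can
only follow the computation; when the machine halts, the queue may be erased
(`TapeLetter.reach_nil_iff`).

*Undecidability.* Mathlib compiles a universal partial recursive function into a single Turing
machine with finitely many reachable states. Hence the rules are fixed and only the initial word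
depends, in a primitive recursive way, on the instance of the halting problem
(`exists_undecidable_queue_system`).
-/

/-! ### Queue systems -/

/-- One step of a queue system with rule set `R`: a rule `(u, v)` removes the word `u` from the
front of the queue and appends the word `v` at its end. -/
def QueueStep {α : Type} (R : Set (List α × List α)) (w w' : List α) : Prop :=
  ∃ r ∈ R, ∃ t, w = r.1 ++ t ∧ w' = t ++ r.2

/-- The queue content `w'` is reachable from `w`. -/
abbrev QueueReach {α : Type} (R : Set (List α × List α)) : List α → List α → Prop :=
  Relation.ReflTransGen (QueueStep R)

section Queue

variable {α : Type} {R : Set (List α × List α)}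

theorem QueueReach.of_rule {u v : List α} (h : (u, v) ∈ R) (t : List α) :
    QueueReach R (u ++ t) (t ++ v) :=
  .single ⟨_, h, t, rfl, rfl⟩

/-- If every letter may be moved from the front to the end, the queue is a cyclic word. -/
theorem QueueReach.of_isRotated (h : ∀ x, ([x], [x]) ∈ R) {w w' : List α} (hw : w ~r w') :
    QueueReach R w w' := by
  obtain ⟨n, rfl⟩ := hw
  induction n with
  | zero => simpa using Relation.ReflTransGen.refl
  | succ n ih =>
    rw [← List.rotate_rotate]
    refine ih.trans ?_
    cases w.rotate n with
    | nil => simpa using Relation.ReflTransGen.refl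
    | cons x t => simpa using QueueReach.of_rule (h x) t

theorem QueueReach.of_rule_isRotated (h : ∀ x, ([x], [x]) ∈ R) {u v t w w' : List α}
    (huv : (u, v) ∈ R) (hw : w ~r u ++ t) (hw' : t ++ v ~r w') : QueueReach R w w' :=
  ((QueueReach.of_isRotated h hw).trans (QueueReach.of_rule huv t)).trans
    (QueueReach.of_isRotated h hw')

end Queue

theorem List.IsRotated.cons_eq_cons {α : Type} {P : α → Prop} {x y : α} {X Y : List α}
    (h : x :: X ~r y :: Y) (hx : P x) (hY : ∀ z ∈ Y, ¬ P z) : x = y ∧ X = Y := by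
  obtain ⟨n, hn, e⟩ := List.isRotated_iff_mod.1 h.symm
  rw [List.rotate_eq_drop_append_take hn] at e
  rcases n with _ | n
  · simpa [eq_comm] using e
  · rw [List.drop_succ_cons] at e
    cases hd : Y.drop n with
    | nil =>
      have hl : Y.length ≤ n := List.drop_eq_nil_iff.1 hd
      rw [hd, List.nil_append, List.take_of_length_le (by simpa using hl)] at e
      simpa [eq_comm] using e
    | cons a l =>
      rw [hd, List.cons_append, List.cons.injEq] at e
      exact (hY a (List.mem_of_mem_drop (by rw [hd]; simp)) (e.1 ▸ hx)).elim

theorem Turing.ListBlank.mk_nil_eq {Γ : Type} [Inhabited Γ] :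
    (Turing.ListBlank.mk [] : Turing.ListBlank Γ) = Turing.ListBlank.mk [default] :=
  Quotient.sound' (Or.inl ⟨1, rfl⟩)

/-! ### Simulating a Turing machine by a queue system -/

/-- The letters of the queue system simulating a Turing machine: tape symbols, machine states, a
marker for the two ends of the tape, and a letter signalling that the machine has halted. -/
inductive TapeLetter (Γ Q : Type) : Type
  | sym (a : Γ)
  | st (q : Q)
  | bd
  | hl

namespace TapeLetter

variable {Γ Λ : Type}

instance {Q : Type} [Finite Γ] [Finite Q] : Finite (TapeLetter Γ Q) :=
  Finite.of_surjective
    (fun x : Γ ⊕ Q ⊕ Bool => match x with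
      | .inl a => sym a
      | .inr (.inl q) => st q
      | .inr (.inr true) => bd
      | .inr (.inr false) => hl)
    (fun x => match x with
      | sym a => ⟨.inl a, rfl⟩
      | st q => ⟨.inr (.inl q), rfl⟩
      | bd => ⟨.inr (.inr true), rfl⟩
      | hl => ⟨.inr (.inr false), rfl⟩)

/-- The queue content encoding a configuration of the machine. -/
def conf {S : Set Λ} (q : S) (L R : List Γ) : List (TapeLetter Γ S) :=
  st q :: (R.map sym ++ bd :: (L.map sym).reverse)

theorem isRotated_conf {S : Set Λ} {q q' : S} {L R : List Γ} {X : List (TapeLetter Γ S)}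
    (h : st q' :: X ~r conf q L R) : q' = q ∧ X = R.map sym ++ bd :: (L.map sym).reverse := by
  have := h.cons_eq_cons (P := fun x => ∃ q, x = st q) ⟨q', rfl⟩
    (by rintro z hz ⟨q, rfl⟩; simp at hz)
  simpa using this

theorem hl_notMem_conf {S : Set Λ} {q : S} {L R : List Γ} : hl ∉ conf q L R := by simp [conf]

variable [Inhabited Γ] [Inhabited Λ] (M : Turing.TM0.Machine Γ Λ) (S : Set Λ)

/-- The rules simulating the Turing machine `M` restricted to the set `S` of states. The queue is
a cyclic word; the tape with left part `L` (nearest cell first) and right part `R` (starting with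
the scanned cell), in state `q`, is `q R # L⁻¹`, where `#` is the letter `bd`. -/
inductive Rule : List (TapeLetter Γ S) × List (TapeLetter Γ S) → Prop
  | rotate (x) : Rule ([x], [x])
  | write (q q' : S) (a b : Γ) (h : M q a = some (q'.1, .write b)) :
      Rule ([st q, sym a], [st q', sym b])
  | right (q q' : S) (a : Γ) (h : M q a = some (q'.1, .move .right)) :
      Rule ([st q, sym a], [sym a, st q'])
  | left (q q' : S) (a c : Γ) (h : M q a = some (q'.1, .move .left)) :
      Rule ([sym c, st q, sym a], [st q', sym c, sym a])
  | extendRight (q : S) : Rule ([st q, bd], [st q, sym default, bd])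
  | extendLeft (q : S) : Rule ([bd, st q], [bd, sym default, st q])
  | halt (q : S) (a : Γ) (h : M q a = none) : Rule ([st q, sym a], [hl])
  | erase (x) : Rule ([hl, x], [hl])
  | vanish : Rule ([hl], [])

/-- The set of all rules simulating `M`. -/
def rules : Set (List (TapeLetter Γ S) × List (TapeLetter Γ S)) := {r | Rule M S r}

theorem finite_rules [Finite Γ] (hS : S.Finite) : (rules M S).Finite := by
  have := hS.to_subtype
  refine ((List.finite_length_le (TapeLetter Γ S) 3).prod
    (List.finite_length_le (TapeLetter Γ S) 3)).subset fun r hr => ?_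
  rcases hr <;> simp

variable {S}

/-- The configuration of the machine with state `q` and the two halves `L`, `R` of the tape. -/
def cfg (q : S) (L R : List Γ) : Turing.TM0.Cfg Γ Λ :=
  ⟨q, Turing.Tape.mk' (.mk L) (.mk R)⟩

variable {M}

theorem reach_extendRight (q : S) (L R : List Γ) : ∃ a R',
    Turing.ListBlank.mk R = .mk (a :: R') ∧
    QueueReach (rules M S) (conf q L R) (conf q L (a :: R')) := by
  cases R with
  | cons a R => exact ⟨a, R, rfl, .refl⟩
  | nil =>
    refine ⟨default, [], Turing.ListBlank.mk_nil_eq,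
      .of_rule_isRotated .rotate (t := (L.map sym).reverse) (.extendRight q) ?_ ?_⟩
    · rfl
    · exact List.isRotated_append

theorem reach_extendLeft (q : S) (L R : List Γ) : ∃ c L',
    Turing.ListBlank.mk L = .mk (c :: L') ∧
    QueueReach (rules M S) (conf q L R) (conf q (c :: L') R) := by
  cases L with
  | cons a L => exact ⟨a, L, rfl, .refl⟩
  | nil =>
    refine ⟨default, [], Turing.ListBlank.mk_nil_eq,
      .of_rule_isRotated .rotate (t := R.map sym) (.extendLeft q) ?_ ?_⟩
    · convert List.isRotated_append (l := st q :: R.map sym) (l' := [bd]) using 1 <;> simp [conf]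
    · convert List.isRotated_append (l := R.map sym ++ [bd, sym default]) (l' := [st q]) using 1 <;> simp [conf]

/-- One step of the Turing machine is simulated by the queue system. -/
theorem reach_of_step (ss : Turing.TM0.Supports M S) {q : S} {L R : List Γ}
    {c : Turing.TM0.Cfg Γ Λ} (hc : c ∈ Turing.TM0.step M (cfg q L R)) :
    ∃ q' L' R', c = cfg q' L' R' ∧
      QueueReach (rules M S) (conf q L R) (conf q' L' R') := by
  obtain ⟨a, R, hR, reachR⟩ := reach_extendRight (M := M) q L R
  obtain ⟨⟨q', s⟩, hM, rfl⟩ := Option.map_eq_some_iff.1 hc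
  simp only [hR, Turing.Tape.mk'_head, Turing.ListBlank.head_mk, List.headI_cons] at hM ⊢
  have hq' : q' ∈ S := ss.2 hM q.2
  cases s with
  | write b =>
    refine ⟨⟨q', hq'⟩, L, b :: R, ?_, reachR.trans (QueueReach.of_rule_isRotated Rule.rotate
      (t := R.map sym ++ bd :: (L.map sym).reverse) (.write q ⟨q', hq'⟩ a b hM) ?_ ?_)⟩
    · simp [cfg, Turing.Tape.write_mk', ← Turing.ListBlank.cons_mk]
    · rfl
    · exact List.isRotated_append
  | move d =>
    cases d with
    | right =>
      refine ⟨⟨q', hq'⟩, a :: L, R, ?_, reachR.trans (QueueReach.of_rule_isRotated .rotate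
        (t := R.map sym ++ bd :: (L.map sym).reverse) (.right q ⟨q', hq'⟩ a hM) ?_ ?_)⟩
      · simp [cfg, Turing.Tape.move_right_mk']
      · rfl
      · convert List.isRotated_append
          (l := R.map sym ++ bd :: (L.map sym).reverse ++ [sym a]) (l' := [st (⟨q', hq'⟩ : S)]) using 1 <;> simp [conf]
    | left =>
      obtain ⟨c, L, hL, reachL⟩ := reach_extendLeft (M := M) q L (a :: R)
      refine ⟨⟨q', hq'⟩, L, c :: a :: R, ?_, reachR.trans (reachL.trans
        (QueueReach.of_rule_isRotated .rotate
        (t := R.map sym ++ bd :: (L.map sym).reverse) (.left q ⟨q', hq'⟩ a c hM) ?_ ?_))⟩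
      · simp [hL, cfg, Turing.Tape.move_left_mk']
      · convert List.isRotated_append
          (l := st q :: sym a :: (R.map sym ++ bd :: (L.map sym).reverse)) (l' := [sym c]) using 1 <;> simp [conf]
      · exact List.isRotated_append

theorem reach_nil_of_hl (t : List (TapeLetter Γ S)) :
    QueueReach (rules M S) (hl :: t) [] := by
  induction t with
  | nil => exact .of_rule (u := [hl]) .vanish []
  | cons x t ih =>
    exact (QueueReach.of_rule_isRotated Rule.rotate (t := t) (Rule.erase x) (List.IsRotated.refl _)
      List.isRotated_append).trans ih

theorem reach_of_reaches (ss : Turing.TM0.Supports M S) {q : S} {L R : List Γ}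
    {c : Turing.TM0.Cfg Γ Λ} (hc : Turing.TM0.Reaches M (cfg q L R) c) :
    ∃ q' L' R', c = cfg q' L' R' ∧
      QueueReach (rules M S) (conf q L R) (conf q' L' R') := by
  induction hc with
  | refl => exact ⟨q, L, R, rfl, .refl⟩
  | tail _ h ih =>
    obtain ⟨q', L', R', rfl, ih⟩ := ih
    obtain ⟨q'', L'', R'', rfl, h'⟩ := reach_of_step ss h
    exact ⟨q'', L'', R'', rfl, ih.trans h'⟩

theorem reach_nil_of_eval_dom (ss : Turing.TM0.Supports M S) {q : S} {L R : List Γ}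
    (h : (StateTransition.eval (Turing.TM0.step M) (cfg q L R)).Dom) :
    QueueReach (rules M S) (conf q L R) [] := by
  obtain ⟨c, hc⟩ := Part.dom_iff_mem.1 h
  obtain ⟨hr, hn⟩ := StateTransition.mem_eval.1 hc
  obtain ⟨q, L, R, rfl, hr'⟩ := reach_of_reaches ss hr
  obtain ⟨a, R, hR, reachR⟩ := reach_extendRight (M := M) q L R
  have hM : M q a = none := by
    simpa [cfg, Turing.TM0.step, hR] using hn
  exact (hr'.trans (reachR.trans (QueueReach.of_rule_isRotated .rotate (.halt q a hM)
    (List.IsRotated.refl _) List.isRotated_append))).trans (reach_nil_of_hl _)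

/-- The invariant of the simulation: a queue content reachable from the encoding of a configuration
`c₀` encodes, up to rotation, a configuration reachable from `c₀`, unless the machine halts. -/
def Inv (M : Turing.TM0.Machine Γ Λ) (c₀ : Turing.TM0.Cfg Γ Λ) (w : List (TapeLetter Γ S)) :
    Prop :=
  (StateTransition.eval (Turing.TM0.step M) c₀).Dom ∨
    ∃ q L R, Turing.TM0.Reaches M c₀ (cfg q L R) ∧ w ~r conf q L R

theorem Inv.step {c₀ : Turing.TM0.Cfg Γ Λ} {w w' : List (TapeLetter Γ S)}
    (h : Inv M c₀ w) (hw : QueueStep (rules M S) w w') : Inv M c₀ w' := by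
  rcases h with h | ⟨q, L, R, hr, hrot⟩
  · exact .inl h
  obtain ⟨⟨u, v⟩, hrule, t, rfl, rfl⟩ := hw
  cases hrule with
  | rotate x => exact .inr ⟨q, L, R, hr, List.isRotated_append.trans hrot⟩
  | erase x => exact (hl_notMem_conf (hrot.mem_iff.1 (by simp))).elim
  | vanish => exact (hl_notMem_conf (hrot.mem_iff.1 (by simp))).elim
  | write p q' a b hM =>
    obtain ⟨rfl, e⟩ := isRotated_conf hrot
    rcases R with _ | ⟨a', R⟩
    · simp at e
    obtain ⟨rfl, rfl⟩ : a = a' ∧ t = _ := by simpa using e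
    refine .inr ⟨q', L, b :: R, hr.tail ?_, List.isRotated_append⟩
    simp [cfg, Turing.TM0.step, hM, Turing.Tape.write_mk', ← Turing.ListBlank.cons_mk]
  | right p q' a hM =>
    obtain ⟨rfl, e⟩ := isRotated_conf hrot
    rcases R with _ | ⟨a', R⟩
    · simp at e
    obtain ⟨rfl, rfl⟩ : a = a' ∧ t = _ := by simpa using e
    refine .inr ⟨q', a :: L, R, hr.tail ?_, ?_⟩
    · simp [cfg, Turing.TM0.step, hM, Turing.Tape.move_right_mk']
    · convert List.isRotated_append
          (l := R.map sym ++ bd :: (L.map sym).reverse ++ [sym a]) (l' := [st q']) using 1 <;> simp [conf]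
  | left p q' a c hM =>
    have hrot : st p :: (sym a :: t ++ [sym c]) ~r conf q L R := by
      refine .trans ?_ hrot
      convert List.isRotated_append (l := st p :: sym a :: t) (l' := [sym c]) using 1 <;> simp
    obtain ⟨rfl, e⟩ := isRotated_conf hrot
    rcases R with _ | ⟨a', R⟩
    · simp at e
    rcases L with _ | ⟨c', L⟩
    · have := congrArg List.getLast? e
      simp [List.getLast?_cons] at this
    obtain ⟨rfl, e⟩ : a = a' ∧ _ := by simpa using e
    have e : t ++ [sym c] = (R.map sym ++ bd :: (L.map sym).reverse) ++ [sym c'] := by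
      simpa using e
    obtain ⟨rfl, e'⟩ := List.append_inj' e rfl
    obtain rfl : c = c' := by simpa using e'
    refine .inr ⟨q', L, c :: a :: R, hr.tail ?_, List.isRotated_append⟩
    simp [cfg, Turing.TM0.step, hM, Turing.Tape.move_left_mk']
  | extendRight p =>
    obtain ⟨rfl, e⟩ := isRotated_conf hrot
    rcases R with _ | ⟨a', R⟩
    · obtain rfl : t = _ := by simpa using e
      refine .inr ⟨p, L, [default], ?_, List.isRotated_append⟩
      rwa [cfg, ← Turing.ListBlank.mk_nil_eq]
    · simp at e
  | extendLeft p =>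
    have hrot : st p :: (t ++ [bd]) ~r conf q L R := by
      refine .trans ?_ hrot
      convert List.isRotated_append (l := st p :: t) (l' := [bd]) using 1 <;> simp
    obtain ⟨rfl, e⟩ := isRotated_conf hrot
    rcases L with _ | ⟨c', L⟩
    · obtain rfl : t = _ := by simpa using e
      refine .inr ⟨p, [default], R, ?_, ?_⟩
      · rwa [cfg, ← Turing.ListBlank.mk_nil_eq]
      · convert List.isRotated_append
          (l := R.map sym ++ [bd, sym default]) (l' := [st p]) using 1 <;> simp [conf]
    · have := congrArg List.getLast? e
      simp [List.getLast?_cons, List.getLast?_append] at this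
  | halt p a hM =>
    obtain ⟨rfl, e⟩ := isRotated_conf hrot
    rcases R with _ | ⟨a', R⟩
    · simp at e
    obtain ⟨rfl, rfl⟩ : a = a' ∧ t = _ := by simpa using e
    refine .inl (Part.dom_iff_mem.2 ⟨_, StateTransition.mem_eval.2 ⟨hr, ?_⟩⟩)
    simp [cfg, Turing.TM0.step, hM]

/-- The queue can be emptied exactly when the Turing machine halts. -/
theorem reach_nil_iff (ss : Turing.TM0.Supports M S) {q : S} {L R : List Γ} :
    QueueReach (rules M S) (conf q L R) [] ↔
      (StateTransition.eval (Turing.TM0.step M) (cfg q L R)).Dom := by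
  refine ⟨fun h => ?_, reach_nil_of_eval_dom ss⟩
  have key : ∀ w, QueueReach (rules M S) (conf q L R) w → Inv M (cfg q L R) w := by
    intro w hw
    induction hw with
    | refl => exact .inr ⟨q, L, R, .refl, List.IsRotated.refl _⟩
    | tail _ h ih => exact ih.step h
  rcases key [] h with h | ⟨_, _, _, _, h⟩
  · exact h
  · simpa [conf] using h.perm.length_eq

end TapeLetter

/-! ### A queue system with an undecidable emptying problem -/

/-- The binary successor on the digit lists (least significant digit first) used as input of the
stack machines of `Turing.PartrecToTM2`. -/
def binSucc (l : List Turing.PartrecToTM2.Γ') : List Turing.PartrecToTM2.Γ' :=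
  l.rec [.bit1] fun d t ih => if d = .bit1 then .bit0 :: ih else .bit1 :: t

theorem binSucc_trPosNum (n : PosNum) :
    binSucc (Turing.PartrecToTM2.trPosNum n) = Turing.PartrecToTM2.trPosNum n.succ := by
  induction n with
  | one => rfl
  | bit0 n => rfl
  | bit1 n ih => exact congrArg (List.cons _) ih

theorem trNat_succ (n : ℕ) :
    Turing.PartrecToTM2.trNat (n + 1) = binSucc (Turing.PartrecToTM2.trNat n) := by
  rw [Turing.PartrecToTM2.trNat, Turing.PartrecToTM2.trNat, Nat.cast_succ, Num.add_one]
  cases (n : Num) with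
  | zero => rfl
  | pos n => exact (binSucc_trPosNum n).symm

theorem primrec_trNat [Primcodable Turing.PartrecToTM2.Γ'] :
    Primrec Turing.PartrecToTM2.trNat := by
  have hs : Primrec binSucc :=
    Primrec.list_rec .id (.const [Turing.PartrecToTM2.Γ'.bit1])
      (Primrec.ite (Primrec.eq.comp (Primrec.fst.comp Primrec.snd) (.const Turing.PartrecToTM2.Γ'.bit1))
        (Primrec.list_cons.comp (.const Turing.PartrecToTM2.Γ'.bit0)
          (Primrec.snd.comp (Primrec.snd.comp Primrec.snd)))
        (Primrec.list_cons.comp (.const Turing.PartrecToTM2.Γ'.bit1)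
          (Primrec.fst.comp (Primrec.snd.comp Primrec.snd)))).to₂
  refine (Primrec.nat_rec₁ [] (hs.comp Primrec.snd).to₂).of_eq fun n => ?_
  induction n with
  | zero => simp
  | succ n ih => rw [trNat_succ, ← ih]

theorem primrec_trInit {K : Type} [DecidableEq K] {Γ : K → Type} [Primcodable (Turing.TM2to1.Γ' K Γ)]
    [Finite (Turing.TM2to1.Γ' K Γ)]
    {k : K} [Finite (Γ k)] [Primcodable (Γ k)] {f : ℕ → List (Γ k)} (hf : Primrec f) :
    Primrec fun n => Turing.TM2to1.trInit k (f n) := by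
  have hg (g : Γ k → Turing.TM2to1.Γ' K Γ) : Primrec g := Primrec.dom_finite g
  let g : Γ k → Turing.TM2to1.Γ' K Γ := fun a =>
    (false, Function.update (fun _ => none) k (some a))
  let b : Turing.TM2to1.Γ' K Γ → Turing.TM2to1.Γ' K Γ := fun x => (true, x.2)
  have hm : Primrec fun n => (f n).reverse.map g :=
    Primrec.list_map (Primrec.list_reverse.comp hf) ((hg g).comp Primrec.snd).to₂
  have hb : Primrec b := Primrec.dom_finite b
  exact Primrec.list_cons.comp (hb.comp (Primrec.list_headI.comp hm))
    (Primrec.list_tail.comp hm)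

/-- There is a Turing machine with an undecidable halting problem on the inputs `l 0, l 1, …`. -/
theorem exists_undecidable_machine : ∃ (Γ Λ : Type) (_ : Inhabited Γ) (_ : Inhabited Λ)
    (_ : Finite Γ) (M : Turing.TM0.Machine Γ Λ) (S : Set Λ) (_ : Primcodable Γ) (l : ℕ → List Γ),
    S.Finite ∧ Turing.TM0.Supports M S ∧ Primrec l ∧
    ¬ ComputablePred fun n => (Turing.TM0.eval M (l n)).Dom := by
  have hf : Partrec fun n : ℕ => Nat.Partrec.Code.eval (Denumerable.ofNat Nat.Partrec.Code n) 0 :=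
    Nat.Partrec.Code.eval_part.comp (Computable.ofNat _) (.const 0)
  obtain ⟨c, hc⟩ := Turing.ToPartrec.Code.exists_code (Nat.Partrec'.part_iff₁.2 hf)
  obtain ⟨_, ⟨e⟩⟩ := Finite.exists_equiv_fin Turing.PartrecToTM2.Γ'
  let _ : Primcodable Turing.PartrecToTM2.Γ' := Primcodable.ofEquiv _ e
  let _ : Fintype Turing.PartrecToTM2.K' :=
    ⟨{.main, .rev, .aux, .stack}, fun x => by cases x <;> simp⟩
  obtain ⟨_, ⟨e'⟩⟩ := Finite.exists_equiv_fin
    (Turing.TM2to1.Γ' Turing.PartrecToTM2.K' fun _ => Turing.PartrecToTM2.Γ')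
  let _ : Primcodable (Turing.TM2to1.Γ' Turing.PartrecToTM2.K' fun _ => Turing.PartrecToTM2.Γ') :=
    Primcodable.ofEquiv _ e'
  let _ : Inhabited Turing.PartrecToTM2.Λ' :=
    ⟨Turing.PartrecToTM2.trNormal c Turing.PartrecToTM2.Cont'.halt⟩
  refine ⟨_, _, inferInstance, inferInstance, inferInstance,
    Turing.TM1to0.tr (Turing.TM2to1.tr Turing.PartrecToTM2.tr), _, inferInstance,
    fun n => Turing.TM2to1.trInit Turing.PartrecToTM2.K'.main (Turing.PartrecToTM2.trList [n]),
    Finset.finite_toSet _,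
    Turing.TM1to0.tr_supports _ (Turing.TM2to1.tr_supports _ (Turing.PartrecToTM2.tr_supports c _)),
    primrec_trInit (Primrec.list_append.comp primrec_trNat (.const _)), fun h => ?_⟩
  refine ComputablePred.halting_problem 0 (ComputablePred.computable_of_manyOneReducible
    ⟨Encodable.encode, Computable.encode, fun c' => ?_⟩ h)
  have hi : Turing.TM2.init Turing.PartrecToTM2.K'.main
      (Turing.PartrecToTM2.trList [Encodable.encode c']) =
      Turing.PartrecToTM2.init c [Encodable.encode c'] := by
    rw [Turing.TM2.init, Turing.PartrecToTM2.init]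
    congr 1
    funext k
    cases k <;> rfl
  have hd : (Turing.ToPartrec.Code.eval c [Encodable.encode c']).Dom ↔
      (Nat.Partrec.Code.eval c' 0).Dom := by
    have := hc ⟨[Encodable.encode c'], rfl⟩
    simp only [List.Vector.head, Denumerable.ofNat_encode] at this
    simp [this]
  refine hd.symm.trans (Iff.trans ?_ (Iff.trans
    (Turing.TM2to1.tr_eval_dom Turing.PartrecToTM2.tr Turing.PartrecToTM2.K'.main _).symm
    (iff_of_eq (congrArg Part.Dom (Turing.TM1to0.tr_eval _ _).symm))))
  change _ ↔ (StateTransition.eval _ _).Dom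
  rw [hi, Turing.PartrecToTM2.tr_eval]
  rfl

open TapeLetter in
/-- There is a finite queue system for which no algorithm decides whether the queue content `w n`
can be rewritten to the empty one. -/
theorem exists_undecidable_queue_system : ∃ (α : Type) (_ : Finite α) (_ : Primcodable α)
    (R : Set (List α × List α)) (w : ℕ → List α), R.Finite ∧ Primrec w ∧
    ¬ ComputablePred fun n => QueueReach R (w n) [] := by
  obtain ⟨Γ, Λ, _, _, _, M, S, _, l, hS, ss, hl, hM⟩ := exists_undecidable_machine
  have := hS.to_subtype
  obtain ⟨n, ⟨e⟩⟩ := Finite.exists_equiv_fin (TapeLetter Γ S)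
  let _ : Primcodable (TapeLetter Γ S) := Primcodable.ofEquiv _ e
  have hsym : Primrec (sym : Γ → TapeLetter Γ S) := Primrec.dom_finite _
  refine ⟨TapeLetter Γ S, inferInstance, inferInstance, rules M S,
    fun n => conf ⟨default, ss.1⟩ [] (l n), finite_rules M S hS, ?_, ?_⟩
  · exact Primrec.list_cons.comp (.const _)
      (Primrec.list_append.comp (Primrec.list_map hl (hsym.comp Primrec.snd).to₂) (.const _))
  · simp only [reach_nil_iff ss]
    exact hM

/-! ### Finite cMSCs from a linearization -/

namespace CMSC

variable {P Msg E K : Type} [LinearOrder K]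

/-- The order generated by a linearization `key` of the events, restricted to each process, and by
the matching relation. -/
def genLe (key : E → K) (lab : E → Act P) (link : E → E → Prop) : E → E → Prop :=
  Relation.ReflTransGen fun a b => ((lab a).proc = (lab b).proc ∧ key a < key b) ∨ link a b

section GenLe

variable {key : E → K} {lab : E → Act P} {link : E → E → Prop}

theorem key_le_of_genLe (hlt : ∀ e f, link e f → key e < key f) {e f : E}
    (h : genLe key lab link e f) : key e ≤ key f := by
  induction h with
  | refl => exact le_rfl
  | tail _ h ih =>
    rcases h with h | h
    · exact ih.trans h.2.le
    · exact ih.trans (hlt _ _ h).le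

theorem genLe_iff_of_proc_eq (hkey : Function.Injective key)
    (hlt : ∀ e f, link e f → key e < key f) {e f : E}
    (h : (lab e).proc = (lab f).proc) : genLe key lab link e f ↔ key e ≤ key f := by
  refine ⟨key_le_of_genLe hlt, fun hle => ?_⟩
  rcases hle.lt_or_eq with hl | he
  · exact .single (.inl ⟨h, hl⟩)
  · rw [hkey he]
    exact .refl

/-- On a finite set of events, the process orders are generated by their direct-successor
relations. -/
theorem reflTransGen_succ [Finite E] (hkey : Function.Injective key)
    (hlt : ∀ e f, link e f → key e < key f) (mu : E → Option Msg) {a b : E}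
    (h : (lab a).proc = (lab b).proc) (hab : key a < key b) :
    Relation.ReflTransGen
      (fun a b => PreCMSC.succ ⟨E, genLe key lab link, link, lab, mu⟩ a b ∨ link a b) a b := by
  have wf : WellFounded fun x y : E => key x < key y := by
    have : IsTrans E fun x y => key x < key y := ⟨fun _ _ _ => lt_trans⟩
    have : Std.Irrefl fun x y : E => key x < key y := ⟨fun _ => lt_irrefl _⟩
    exact Finite.wellFounded_of_trans_of_irrefl _
  induction b using wf.induction with
  | _ b ih =>
    -- the direct predecessor of `b` on its process
    obtain ⟨g, ⟨hg, hag, hgb⟩, hmax⟩ := Set.exists_max_image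
      {g | (lab g).proc = (lab a).proc ∧ key a ≤ key g ∧ key g < key b} key (Set.toFinite _)
      ⟨a, rfl, le_rfl, hab⟩
    have hgb' : (lab g).proc = (lab b).proc := hg.trans h
    have hlast : PreCMSC.succ ⟨E, genLe key lab link, link, lab, mu⟩ g b := by
      refine ⟨hgb', ⟨(genLe_iff_of_proc_eq hkey hlt hgb').2 hgb.le, ?_⟩, ?_⟩
      · rintro rfl
        exact lt_irrefl _ hgb
      · rintro ⟨x, hx, ⟨hgx, hne⟩, hxb, hne'⟩
        have h1 := key_le_of_genLe hlt hgx
        have h2 : key x < key b :=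
          (key_le_of_genLe hlt hxb).lt_of_ne fun e => hne' (hkey e)
        exact hne (hkey (h1.antisymm (hmax x ⟨hx.trans hg, hag.trans h1, h2⟩)))
    rcases hag.lt_or_eq with hl | he
    · exact (ih g hgb hg.symm hl).tail (.inl hlast)
    · rw [hkey he]
      exact .single (.inl hlast)

end GenLe

/-- The finite cMSC with linearization `key`, labelling `lab`, matching `link` and messages `mu`:
all matched pairs have to be ordered by the linearization, and all other conditions are to be
checked for the linearization. -/
def ofKey [Finite E] [Nonempty E] (key : E → K) (hkey : Function.Injective key)
    (lab : E → Act P) (link : E → E → Prop) (mu : E → Option Msg)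
    (hlt : ∀ e f, link e f → key e < key f)
    (hlab : ∀ e f, link e f →
      ∃ (p q : P) (h : p ≠ q), lab e = Act.send p q h ∧ lab f = Act.recv q p h.symm)
    (hfifo : ∀ e f e' f', link e f → link e' f' → (lab e).proc = (lab e').proc →
      (lab f).proc = (lab f').proc → (key e ≤ key e' ↔ key f ≤ key f'))
    (hmu : ∀ e, (mu e).isSome = true ↔ ¬ ∃ f, link e f ∨ link f e)
    (hsend : ∀ e f g, link e f → (¬ ∃ f, link g f ∨ link f g) → lab g = lab e → key e < key g)
    (hrecv : ∀ e f g, link e f → (¬ ∃ f, link g f ∨ link f g) → lab g = lab f → key g < key f) :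
    CMSC P Msg where
  E := E
  le := genLe key lab link
  link := link
  lab := lab
  mu := mu
  nonempty := inferInstance
  countable := inferInstance
  le_refl _ := .refl
  le_antisymm _ _ h h' := hkey ((key_le_of_genLe hlt h).antisymm (key_le_of_genLe hlt h'))
  le_trans _ _ _ := .trans
  proc_total e f h := by
    have h : (lab e).proc = (lab f).proc := h
    rw [genLe_iff_of_proc_eq hkey hlt h, genLe_iff_of_proc_eq hkey hlt h.symm]
    exact le_total _ _
  proc_order _ := .inl inferInstance
  link_lab := hlab
  fifo e f e' f' h h' he hf := by
    rw [genLe_iff_of_proc_eq hkey hlt he, genLe_iff_of_proc_eq hkey hlt hf]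
    exact hfifo e f e' f' h h' he hf
  le_iff e f := by
    constructor
    · intro h
      induction h with
      | refl => exact .refl
      | tail _ h ih =>
        rcases h with h | h
        · exact ih.trans (reflTransGen_succ hkey hlt mu h.1 h.2)
        · exact ih.tail (.inr h)
    · intro h
      induction h with
      | refl => exact .refl
      | tail _ h ih =>
        rcases h with h | h
        · exact ih.trans h.2.1.1
        · exact ih.tail (.inr h)
  mu_dom := hmu
  unmatched_send e f g h hg hl :=
    ⟨(genLe_iff_of_proc_eq hkey hlt (congrArg Act.proc hl.symm)).2 (hsend e f g h hg hl).le, by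
      rintro rfl
      exact lt_irrefl _ (hsend e f e h hg hl)⟩
  unmatched_recv e f g h hg hl :=
    ⟨(genLe_iff_of_proc_eq hkey hlt (congrArg Act.proc hl)).2 (hrecv e f g h hg hl).le, by
      rintro rfl
      exact lt_irrefl _ (hrecv e g g h hg hl)⟩

end CMSC

/-! ### The cMSC of a queue rule -/

/-- The events of the cMSC of a queue rule that removes `a` letters and appends `b` letters: a
matched synchronization message, the receptions of the removed letters and the emissions of the
appended ones. -/
inductive BlockEvent (a b : ℕ) : Type
  | syncSend
  | syncRecv
  | pop (i : Fin a)
  | push (j : Fin b)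

namespace BlockEvent

variable {a b : ℕ}

/-- The position of an event in a linearization. -/
def pos : BlockEvent a b → ℕ
  | syncSend => 0
  | syncRecv => 1
  | pop i => 2 + i
  | push j => 2 + a + j

theorem pos_injective : Function.Injective (pos : BlockEvent a b → ℕ) := by
  rintro (_ | _ | i | j) (_ | _ | i' | j') h <;> simp only [pos] at h <;> grind

theorem pos_lt (x : BlockEvent a b) : x.pos < 2 + a + b := by
  rcases x with _ | _ | i | j <;> simp only [pos] <;> grind

theorem exists_pos_eq {n : ℕ} (h : n < 2 + a + b) : ∃ x : BlockEvent a b, x.pos = n := by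
  rcases lt_or_ge n 2 with h2 | h2
  · interval_cases n
    · exact ⟨syncSend, rfl⟩
    · exact ⟨syncRecv, rfl⟩
  · rcases lt_or_ge n (2 + a) with h3 | h3
    · exact ⟨pop ⟨n - 2, by lia⟩, by simp only [pos]; lia⟩
    · exact ⟨push ⟨n - (2 + a), by lia⟩, by simp only [pos]; lia⟩

instance : Nonempty (BlockEvent a b) := ⟨syncSend⟩

instance : Finite (BlockEvent a b) :=
  Finite.of_injective (fun x => (⟨x.pos, x.pos_lt⟩ : Fin (2 + a + b)))
    fun _ _ h => pos_injective (congrArg Fin.val h)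

variable {P : Type} {p q : P}

/-- Process `p` appends letters to the queue, process `q` removes letters from it, and `q`
synchronizes with `p`. -/
def lab (hpq : p ≠ q) : BlockEvent a b → Act P
  | syncSend => .send q p hpq.symm
  | syncRecv => .recv p q hpq
  | pop _ => .recv q p hpq.symm
  | push _ => .send p q hpq

theorem exists_pop_of_lab_eq {hpq : p ≠ q} {x : BlockEvent a b} {h : q ≠ p}
    (hx : lab hpq x = .recv q p h) : ∃ i, x = pop i := by
  rcases x with _ | _ | i | j
  · cases hx
  · exact (hpq (Act.recv.inj hx).1).elim
  · exact ⟨i, rfl⟩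
  · cases hx

theorem exists_push_of_lab_eq {hpq : p ≠ q} {x : BlockEvent a b} {h : p ≠ q}
    (hx : lab hpq x = .send p q h) : ∃ j, x = push j := by
  rcases x with _ | _ | i | j
  · exact (hpq.symm (Act.send.inj hx).1).elim
  · cases hx
  · cases hx
  · exact ⟨j, rfl⟩

/-- The letters removed and appended are the messages of the unmatched events. -/
def mu {α : Type} (u v : List α) : BlockEvent u.length v.length → Option α
  | syncSend => none
  | syncRecv => none
  | pop i => some (u.get i)
  | push j => some (v.get j)

end BlockEvent

section Block

variable {P α : Type} {p q : P}

open BlockEvent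

/-- The cMSC of the queue rule `(u, v)`: process `q` receives the word `u`, process `p` sends the
word `v`, and a matched message from `q` to `p` makes the cMSC connected. -/
def block (hpq : p ≠ q) (r : List α × List α) : CMSC P α :=
  CMSC.ofKey (E := BlockEvent r.1.length r.2.length) pos pos_injective (lab hpq)
    (fun e f => e = syncSend ∧ f = syncRecv) (mu r.1 r.2)
    (by rintro _ _ ⟨rfl, rfl⟩; simp [pos])
    (by rintro _ _ ⟨rfl, rfl⟩; exact ⟨q, p, hpq.symm, rfl, rfl⟩)
    (by rintro _ _ _ _ ⟨rfl, rfl⟩ ⟨rfl, rfl⟩; simp)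
    (by rintro (_ | _ | i | j) <;> simp [mu])
    (by rintro _ _ (_ | _ | i | j) ⟨rfl, rfl⟩ <;> simp [lab, hpq, hpq.symm])
    (by rintro _ _ (_ | _ | i | j) ⟨rfl, rfl⟩ <;> simp [lab, hpq, hpq.symm])

theorem block_le_iff (hpq : p ≠ q) (r : List α × List α) {e f : (block hpq r).E}
    (h : (block hpq r).proc e = (block hpq r).proc f) :
    (block hpq r).le e f ↔ pos e ≤ pos f :=
  CMSC.genLe_iff_of_proc_eq pos_injective (by rintro _ _ ⟨rfl, rfl⟩; simp [pos]) h

/-- The description of `block` as finite data. -/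
def blockCode {k : ℕ} (p q : Fin k) (τ : α → ℕ) (r : List α × List α) : CMSCCode k :=
  (((true, q, p), none) :: ((false, p, q), none) ::
    (r.1.map (fun x => ((false, q, p), some (τ x))) ++
      r.2.map (fun x => ((true, p, q), some (τ x)))), [(0, 1)])

theorem blockCode_represents {k m : ℕ} {p q : Fin k} (hpq : p ≠ q) (τ : α ≃ Fin m)
    (r : List α × List α) :
    (blockCode p q (fun x => (τ x : ℕ)) r).Represents τ (block hpq r) := by
  have hlen : (blockCode p q (fun x => (τ x : ℕ)) r).1.length = 2 + r.1.length + r.2.length := by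
    simp [blockCode]; lia
  let φ : BlockEvent r.1.length r.2.length ≃
      Fin (blockCode p q (fun x => (τ x : ℕ)) r).1.length :=
    Equiv.ofBijective (fun x => ⟨x.pos, by rw [hlen]; exact x.pos_lt⟩)
      ⟨fun _ _ h => pos_injective (congrArg Fin.val h), fun n => by
        obtain ⟨x, hx⟩ := exists_pos_eq (n.2.trans_eq hlen)
        exact ⟨x, Fin.ext hx⟩⟩
  have hφ x : (φ x : ℕ) = x.pos := rfl
  have hget x : (blockCode p q (fun x => (τ x : ℕ)) r).1[(φ x : ℕ)]? =
      some ((lab hpq x).code, (mu r.1 r.2 x).map fun a => (τ a : ℕ)) := by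
    rw [hφ]
    rcases x with _ | _ | i | j
    · rfl
    · rfl
    · simp [pos, blockCode, add_comm 2, List.getElem?_append, lab, mu, Act.code]
    · simp [pos, blockCode, add_comm 2, add_right_comm, lab, mu, Act.code]
  have hget' x : (blockCode p q (fun x => (τ x : ℕ)) r).1.get (φ x) =
      ((lab hpq x).code, (mu r.1 r.2 x).map fun a => (τ a : ℕ)) := by
    simpa using hget x
  have hlink (e f : BlockEvent r.1.length r.2.length) : e = syncSend ∧ f = syncRecv ↔
      (e.pos, f.pos) ∈ (blockCode p q (fun x => (τ x : ℕ)) r).2 := by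
    simp only [blockCode, List.mem_singleton, Prod.mk.injEq]
    exact and_congr (pos_injective.eq_iff' rfl).symm (pos_injective.eq_iff' rfl).symm
  exact ⟨φ, fun e => (congrArg Prod.fst (hget' e)).symm, fun e => (congrArg Prod.snd (hget' e)).symm,
    fun _ _ h => block_le_iff hpq r h, hlink⟩

end Block

/-! ### Prefixes of the queue's input and output -/

/-- The concatenation of the first `n` words of a sequence of words. -/
def catPrefix {α : Type} (w : ℕ → List α) : ℕ → List α
  | 0 => []
  | n + 1 => catPrefix w n ++ w n

section CatPrefix

variable {α : Type} {w : ℕ → List α}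

theorem catPrefix_isPrefix {m n : ℕ} (h : m ≤ n) : catPrefix w m <+: catPrefix w n := by
  induction n, h using Nat.le_induction with
  | base => exact List.prefix_rfl
  | succ n _ ih => exact ih.trans (List.prefix_append _ _)

theorem catPrefix_congr {w' : ℕ → List α} {n : ℕ} (h : ∀ i < n, w i = w' i) :
    catPrefix w n = catPrefix w' n := by
  induction n with
  | zero => rfl
  | succ n ih =>
    rw [catPrefix, catPrefix, ih fun i hi => h i (hi.trans n.lt_succ_self), h n n.lt_succ_self]

theorem catPrefix_index_lt {i n j : ℕ} (hi : i < n) (hj : j < (w i).length) :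
    (catPrefix w i).length + j < (catPrefix w n).length := by
  have := (catPrefix_isPrefix (w := w) hi).length_le
  simp only [catPrefix, List.length_append] at this
  lia

theorem catPrefix_getElem? {i n j : ℕ} (hi : i < n) (hj : j < (w i).length) :
    (catPrefix w n)[(catPrefix w i).length + j]? = some (w i)[j] := by
  obtain ⟨t, ht⟩ := catPrefix_isPrefix (w := w) hi
  rw [← ht, catPrefix, List.getElem?_append_left (by simpa using hj),
    List.getElem?_append_right (by simp)]
  simp

theorem exists_catPrefix_index {n a : ℕ} (h : a < (catPrefix w n).length) :
    ∃ i j, i < n ∧ j < (w i).length ∧ (catPrefix w i).length + j = a := by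
  induction n with
  | zero => simp [catPrefix] at h
  | succ n ih =>
    rcases lt_or_ge a (catPrefix w n).length with hlt | hge
    · obtain ⟨i, j, hi, hj, e⟩ := ih hlt
      exact ⟨i, j, hi.trans n.lt_succ_self, hj, e⟩
    · simp only [catPrefix, List.length_append] at h
      exact ⟨n, a - (catPrefix w n).length, n.lt_succ_self, by lia, by lia⟩

/-- The position of a letter in the concatenation is monotone for the lexicographic order. -/
theorem catPrefix_index_le_iff {i i' j j' : ℕ} (hj : j < (w i).length)
    (hj' : j' < (w i').length) :
    (catPrefix w i).length + j ≤ (catPrefix w i').length + j' ↔ i < i' ∨ i = i' ∧ j ≤ j' := by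
  rcases lt_trichotomy i i' with h | rfl | h
  · have := catPrefix_index_lt h hj
    simp only [h, true_or, iff_true]
    lia
  · simp
  · have := catPrefix_index_lt h hj'
    lia

end CatPrefix

/-- The rules `r 0, …, r (n - 1)` lead from the empty queue to the empty queue: what is removed up to
rule `i` has been appended before rule `i`, and in the end, everything has been removed. -/
def IsQueueRun {α : Type} (r : ℕ → List α × List α) (n : ℕ) : Prop :=
  (∀ i < n, catPrefix (fun i => (r i).1) (i + 1) <+: catPrefix (fun i => (r i).2) i) ∧
    catPrefix (fun i => (r i).1) n = catPrefix (fun i => (r i).2) n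

theorem QueueReach.exists_rules {α : Type} {R : Set (List α × List α)} {w w' : List α}
    (h : QueueReach R w w') : ∃ (r : ℕ → List α × List α) (n : ℕ), 1 ≤ n ∧ r 0 = ([], w) ∧
      (∀ i, 1 ≤ i → i < n → r i ∈ R) ∧
      (∀ i < n, catPrefix (fun i => (r i).1) (i + 1) <+: catPrefix (fun i => (r i).2) i) ∧
      catPrefix (fun i => (r i).1) n ++ w' = catPrefix (fun i => (r i).2) n := by
  induction h with
  | refl =>
    refine ⟨fun _ => ([], w), 1, le_rfl, rfl, fun i h h' => by lia, fun i h => ?_, ?_⟩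
    · obtain rfl : i = 0 := by lia
      simp [catPrefix]
    · simp [catPrefix]
  | tail _ hstep ih =>
    obtain ⟨r, n, hn, h0, hR, hpre, hend⟩ := ih
    obtain ⟨s, hs, t, rfl, rfl⟩ := hstep
    have hne : ∀ i < n, Function.update r n s i = r i := fun i hi =>
      Function.update_of_ne hi.ne _ _
    have hu : ∀ m ≤ n, catPrefix (fun i => (Function.update r n s i).1) m =
        catPrefix (fun i => (r i).1) m := fun m hm =>
      catPrefix_congr fun i hi => by rw [hne i (hi.trans_le hm)]
    have hv : ∀ m ≤ n, catPrefix (fun i => (Function.update r n s i).2) m =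
        catPrefix (fun i => (r i).2) m := fun m hm =>
      catPrefix_congr fun i hi => by rw [hne i (hi.trans_le hm)]
    refine ⟨Function.update r n s, n + 1, by lia, by rw [hne 0 (by lia), h0], fun i h h' => ?_,
      fun i hi => ?_, ?_⟩
    · rcases Nat.lt_succ_iff_lt_or_eq.1 h' with hi | rfl
      · rw [hne i hi]
        exact hR i h hi
      · rwa [Function.update_self]
    · rcases Nat.lt_succ_iff_lt_or_eq.1 hi with hi | rfl
      · rw [hu _ hi, hv _ hi.le]
        exact hpre i hi
      · rw [catPrefix, hu _ le_rfl, hv _ le_rfl, Function.update_self, ← hend]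
        exact ⟨t, by simp⟩
    · rw [catPrefix, catPrefix, hu _ le_rfl, hv _ le_rfl, Function.update_self, ← hend]
      simp

theorem QueueReach.of_rules {α : Type} {R : Set (List α × List α)} {w : List α}
    {r : ℕ → List α × List α} {n : ℕ} (h0 : r 0 = ([], w))
    (hR : ∀ i, 1 ≤ i → i < n → r i ∈ R)
    (hpre : ∀ i < n, catPrefix (fun i => (r i).1) (i + 1) <+: catPrefix (fun i => (r i).2) i)
    {m : ℕ} (hm : 1 ≤ m) (hmn : m ≤ n) :
    ∃ w', QueueReach R w w' ∧
      catPrefix (fun i => (r i).1) m ++ w' = catPrefix (fun i => (r i).2) m := by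
  induction m, hm using Nat.le_induction with
  | base => exact ⟨w, .refl, by simp [catPrefix, h0]⟩
  | succ m hm ih =>
    obtain ⟨w', hw', e⟩ := ih (by lia)
    obtain ⟨t, ht⟩ := hpre m hmn
    rw [catPrefix, ← e, List.append_assoc, List.append_cancel_left_eq] at ht
    refine ⟨t ++ (r m).2, hw'.tail ⟨r m, hR m hm hmn, t, ht.symm, rfl⟩, ?_⟩
    rw [catPrefix, catPrefix, ← e, ← ht]
    simp

/-- The queue content `w` can be emptied if and only if there is a run from the empty queue to
itself that starts by appending `w`. -/
theorem queueReach_nil_iff {α : Type} {R : Set (List α × List α)} {w : List α} :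
    QueueReach R w [] ↔ ∃ (r : ℕ → List α × List α) (n : ℕ), 1 ≤ n ∧ r 0 = ([], w) ∧
      (∀ i, 1 ≤ i → i < n → r i ∈ R) ∧ IsQueueRun r n := by
  constructor
  · intro h
    obtain ⟨r, n, hn, h0, hR, hpre, hend⟩ := h.exists_rules
    exact ⟨r, n, hn, h0, hR, hpre, by simpa using hend⟩
  · rintro ⟨r, n, hn, h0, hR, hpre, hend⟩
    obtain ⟨w', hw', e⟩ := QueueReach.of_rules h0 hR hpre hn le_rfl
    obtain rfl : w' = [] := by simpa [hend] using e
    exact hw'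

/-- A monotone relation between two initial segments of the natural numbers that is total on both
sides is the identity. -/
theorem eq_of_monotone_matching {T : ℕ → ℕ → Prop} {A B : ℕ} (hT : ∀ a b, T a b → a < A ∧ b < B)
    (hA : ∀ a < A, ∃ b, T a b) (hB : ∀ b < B, ∃ a, T a b)
    (hmono : ∀ a b a' b', T a b → T a' b' → (a ≤ a' ↔ b ≤ b')) {a b : ℕ} (h : T a b) :
    a = b := by
  induction a using Nat.strong_induction_on generalizing b with
  | _ a ih =>
    rcases lt_trichotomy a b with hlt | rfl | hlt
    · obtain ⟨a', ha'⟩ := hB a (hlt.trans (hT _ _ h).2)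
      have h1 := hmono _ _ _ _ h ha'
      have h2 := ih a' (by lia) ha'
      lia
    · rfl
    · obtain ⟨b', hb'⟩ := hA b (hlt.trans (hT _ _ h).1)
      obtain rfl := ih b hlt hb'
      have := hmono _ _ _ _ h hb'
      lia

theorem eq_of_monotone_matching_bound {T : ℕ → ℕ → Prop} {A B : ℕ}
    (hT : ∀ a b, T a b → a < A ∧ b < B)
    (hA : ∀ a < A, ∃ b, T a b) (hB : ∀ b < B, ∃ a, T a b)
    (hmono : ∀ a b a' b', T a b → T a' b' → (a ≤ a' ↔ b ≤ b')) : A = B := by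
  rcases lt_trichotomy A B with hlt | rfl | hlt
  · obtain ⟨a, ha⟩ := hB A hlt
    have := eq_of_monotone_matching hT hA hB hmono ha
    exact (lt_irrefl A (this ▸ (hT _ _ ha).1)).elim
  · rfl
  · obtain ⟨b, hb⟩ := hA B hlt
    have := eq_of_monotone_matching hT hA hB hmono hb
    exact (lt_irrefl B (this ▸ (hT _ _ hb).2)).elim

/-! ### Products of queue rules -/

open BlockEvent

/-- The events of a product of `n` queue rules. -/
abbrev RunEvent {α : Type} (r : ℕ → List α × List α) (n : ℕ) : Type :=
  Σ i : Fin n, BlockEvent (r i).1.length (r i).2.length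

namespace RunEvent

variable {α P : Type} {r : ℕ → List α × List α} {n : ℕ}

/-- The linearization of the product: first by the index of the factor, then as in the factor. -/
def key (x : RunEvent r n) : ℕ ×ₗ ℕ := toLex ((x.1 : ℕ), x.2.pos)

theorem key_injective : Function.Injective (key : RunEvent r n → ℕ ×ₗ ℕ) := by
  rintro ⟨i, e⟩ ⟨i', f⟩ h
  have h : ((i : ℕ), e.pos) = ((i' : ℕ), f.pos) := toLex.injective h
  obtain ⟨hi, hp⟩ := Prod.mk.inj h
  obtain rfl := Fin.ext hi
  rw [pos_injective hp]

theorem key_le_iff {i i' : Fin n} {e : BlockEvent (r i).1.length (r i).2.length}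
    {f : BlockEvent (r i').1.length (r i').2.length} :
    key (r := r) ⟨i, e⟩ ≤ key (r := r) ⟨i', f⟩ ↔ i < i' ∨ i = i' ∧ e.pos ≤ f.pos := by
  rw [key, key, Prod.Lex.toLex_le_toLex]
  simp [Fin.ext_iff]

theorem key_lt_of_lt {i i' : Fin n} {e : BlockEvent (r i).1.length (r i).2.length}
    {f : BlockEvent (r i').1.length (r i').2.length} (h : i < i') :
    key (r := r) ⟨i, e⟩ < key (r := r) ⟨i', f⟩ := by
  rw [key, key, Prod.Lex.toLex_lt_toLex]
  exact .inl h

/-- On each process, the order of a product of rules is the one of its linearization. -/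
theorem lex_iff {p q : P} (hpq : p ≠ q) {x y : RunEvent r n}
    (h : (lab hpq x.2).proc = (lab hpq y.2).proc) :
    Sigma.Lex (ι := Fin n) (α := fun i => (block hpq (r i)).E) (· < ·)
      (fun i => (block hpq (r i)).le) x y ↔ key x ≤ key y := by
  obtain ⟨i, e⟩ := x
  obtain ⟨i', f⟩ := y
  refine Sigma.lex_iff.trans ?_
  rw [key_le_iff]
  refine or_congr Iff.rfl ⟨?_, ?_⟩
  · rintro ⟨hi, hle⟩
    change i = i' at hi
    subst hi
    exact ⟨rfl, (block_le_iff hpq (r i) h).1 hle⟩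
  · rintro ⟨rfl, hle⟩
    exact ⟨rfl, (block_le_iff hpq (r i) h).2 hle⟩

theorem key_push_le_iff {i i' : Fin n} {j : Fin (r i).2.length} {j' : Fin (r i').2.length} :
    key (r := r) ⟨i, push j⟩ ≤ key (r := r) ⟨i', push j'⟩ ↔
      (catPrefix (fun i => (r i).2) i).length + j ≤
        (catPrefix (fun i => (r i).2) i').length + j' := by
  rw [key_le_iff, catPrefix_index_le_iff j.2 j'.2]
  refine or_congr Iff.rfl ⟨?_, ?_⟩
  · rintro ⟨rfl, h⟩
    simpa [pos] using h
  · rintro ⟨hi, h⟩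
    obtain rfl := Fin.ext hi
    simpa [pos] using h

theorem key_pop_le_iff {i i' : Fin n} {j : Fin (r i).1.length} {j' : Fin (r i').1.length} :
    key (r := r) ⟨i, pop j⟩ ≤ key (r := r) ⟨i', pop j'⟩ ↔
      (catPrefix (fun i => (r i).1) i).length + j ≤
        (catPrefix (fun i => (r i).1) i').length + j' := by
  rw [key_le_iff, catPrefix_index_le_iff j.2 j'.2]
  refine or_congr Iff.rfl ⟨?_, ?_⟩
  · rintro ⟨rfl, h⟩
    simpa [pos] using h
  · rintro ⟨hi, h⟩
    obtain rfl := Fin.ext hi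
    simpa [pos] using h

/-- The matching of the product: the synchronization messages are matched inside the factors, and
the `a`-th letter appended to the queue is matched with the `a`-th letter removed. -/
def link : RunEvent r n → RunEvent r n → Prop
  | ⟨i, syncSend⟩, ⟨i', syncRecv⟩ => i = i'
  | ⟨i, push j⟩, ⟨i', pop j'⟩ => (catPrefix (fun i => (r i).2) i).length + j =
      (catPrefix (fun i => (r i).1) i').length + j'
  | _, _ => False

/-- Each letter that a run removes has been appended, at the same position, by an earlier rule. -/
theorem exists_push (h : IsQueueRun r n) (i : Fin n) (j : Fin (r i).1.length) :
    ∃ (i' : Fin n) (j' : Fin (r i').2.length), i' < i ∧ (r i).1.get j = (r i').2.get j' ∧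
      link (r := r) ⟨i', push j'⟩ ⟨i, pop j⟩ := by
  have h1 := catPrefix_index_lt (w := fun i => (r i).1) (Nat.lt_succ_self i) j.2
  obtain ⟨i', j', hi', hj', e⟩ := exists_catPrefix_index
    (w := fun i => (r i).2) (h1.trans_le (h.1 i i.2).length_le)
  have hget := catPrefix_getElem? (w := fun i => (r i).1) i.2 j.2
  rw [h.2, ← e, catPrefix_getElem? (w := fun i => (r i).2) (hi'.trans i.2) hj'] at hget
  exact ⟨⟨i', hi'.trans i.2⟩, ⟨j', hj'⟩, hi', by simpa using hget.symm, e⟩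

theorem exists_pop (h : IsQueueRun r n) (i : Fin n) (j : Fin (r i).2.length) :
    ∃ (i' : Fin n) (j' : Fin (r i').1.length), link (r := r) ⟨i, push j⟩ ⟨i', pop j'⟩ := by
  have h1 := catPrefix_index_lt (w := fun i => (r i).2) i.2 j.2
  rw [← h.2] at h1
  obtain ⟨i', j', hi', hj', e⟩ := exists_catPrefix_index h1
  exact ⟨⟨i', hi'⟩, ⟨j', hj'⟩, e.symm⟩

theorem lt_of_link (h : IsQueueRun r n) {i i' : Fin n} {j : Fin (r i).2.length}
    {j' : Fin (r i').1.length} (hl : link (r := r) ⟨i, push j⟩ ⟨i', pop j'⟩) :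
    i < i' ∧ (r i).2.get j = (r i').1.get j' := by
  obtain ⟨i₀, j₀, hi, hget, hl₀⟩ := exists_push h i' j'
  have hl : (catPrefix (fun i => (r i).2) i).length + j = _ := hl
  have hl₀ : (catPrefix (fun i => (r i).2) i₀).length + j₀ = _ := hl₀
  have h1 := (catPrefix_index_le_iff (w := fun i => (r i).2) j.2 j₀.2).1 (by lia)
  have h2 := (catPrefix_index_le_iff (w := fun i => (r i).2) j₀.2 j.2).1 (by lia)
  obtain rfl : i = i₀ := Fin.ext (by lia)
  obtain rfl : j = j₀ := Fin.ext (by lia)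
  exact ⟨hi, hget.symm⟩

theorem exists_link (h : IsQueueRun r n) (x : RunEvent r n) : ∃ y, link x y ∨ link y x := by
  obtain ⟨i, _ | _ | j | j⟩ := x
  · exact ⟨⟨i, syncRecv⟩, .inl rfl⟩
  · exact ⟨⟨i, syncSend⟩, .inr rfl⟩
  · obtain ⟨i', j', _, _, hl⟩ := exists_push h i j
    exact ⟨_, .inr hl⟩
  · obtain ⟨i', j', hl⟩ := exists_pop h i j
    exact ⟨_, .inl hl⟩

theorem link_cases {x y : RunEvent r n} (h : link x y) :
    (∃ i, x = ⟨i, syncSend⟩ ∧ y = ⟨i, syncRecv⟩) ∨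
      ∃ i j i' j', x = ⟨i, push j⟩ ∧ y = ⟨i', pop j'⟩ := by
  obtain ⟨i, _ | _ | j | j⟩ := x <;> obtain ⟨i', _ | _ | j' | j'⟩ := y <;>
    simp only [link] at h
  · subst h
    exact .inl ⟨i, rfl, rfl⟩
  · exact .inr ⟨i, j, i', j', rfl, rfl⟩

theorem key_lt_of_link (h : IsQueueRun r n) {x y : RunEvent r n} (hl : link x y) :
    key x < key y := by
  rcases link_cases hl with ⟨i, rfl, rfl⟩ | ⟨i, j, i', j', rfl, rfl⟩
  · rw [key, key, Prod.Lex.toLex_lt_toLex]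
    exact .inr ⟨rfl, by simp [pos]⟩
  · exact key_lt_of_lt (lt_of_link h hl).1

/-- The MSC of a run of the queue system. -/
def msc {p q : P} (hpq : p ≠ q) (h : IsQueueRun r n) (hn : 1 ≤ n) : CMSC P α :=
  have : Nonempty (RunEvent r n) := ⟨⟨⟨0, hn⟩, syncSend⟩⟩
  CMSC.ofKey (E := RunEvent r n) key key_injective (fun x => lab hpq x.2) link (fun _ => none)
    (fun _ _ => key_lt_of_link h)
    (by
      intro x y hl
      rcases link_cases hl with ⟨i, rfl, rfl⟩ | ⟨i, j, i', j', rfl, rfl⟩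
      · exact ⟨q, p, hpq.symm, rfl, rfl⟩
      · exact ⟨p, q, hpq, rfl, rfl⟩)
    (by
      intro x y x' y' hl hl' hx hy
      rcases link_cases hl with ⟨i, rfl, rfl⟩ | ⟨i, j, i₁, j₁, rfl, rfl⟩ <;>
        rcases link_cases hl' with ⟨i', rfl, rfl⟩ | ⟨i', j', i₁', j₁', rfl, rfl⟩
      · simp [key_le_iff, pos]
      · exact (hpq hx.symm).elim
      · exact (hpq hx).elim
      · rw [key_push_le_iff, key_pop_le_iff]
        exact iff_of_eq (congrArg₂ _ hl hl'))
    (fun x => by simpa only [Option.isSome_none, Bool.false_eq_true, false_iff, not_not] using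
      exists_link h x)
    (fun _ _ g _ hg => (hg (exists_link h g)).elim)
    (fun _ _ g _ hg => (hg (exists_link h g)).elim)

theorem isMSC_msc {p q : P} (hpq : p ≠ q) (h : IsQueueRun r n) (hn : 1 ≤ n) :
    (msc hpq h hn).IsMSC :=
  fun x hx => hx (exists_link h x)

theorem isProduct_msc {p q : P} (hpq : p ≠ q) (h : IsQueueRun r n) (hn : 1 ≤ n) :
    CMSC.IsProduct (fun i : Fin n => block hpq (r i)) (msc hpq h hn) := by
  refine ⟨Equiv.refl (RunEvent r n), fun x => rfl, ?_, ?_, ?_, fun x hx => ?_⟩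
  · intro x y hxy
    refine (CMSC.genLe_iff_of_proc_eq key_injective (fun _ _ => key_lt_of_link h) hxy).trans ?_
    exact (lex_iff hpq hxy).symm
  · rintro i e f ⟨rfl, rfl⟩
    rfl
  · intro x y hl
    rcases link_cases hl with ⟨i, rfl, rfl⟩ | ⟨i, j, i', j', rfl, rfl⟩
    · exact .inl ⟨i, syncSend, syncRecv, rfl, rfl, rfl, rfl⟩
    · obtain ⟨hi, hget⟩ := lt_of_link h hl
      exact .inr ⟨hi, congrArg some hget⟩
  · exact (hx (exists_link h x)).elim

end RunEvent

section Product

variable {α P : Type} {r : ℕ → List α × List α} {n : ℕ} {p q : P} {hpq : p ≠ q} {N : CMSC P α}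

/-- Every product of queue rules is connected: each process is, and the synchronization message of
the first factor links the two processes. -/
theorem isConnected_of_isProduct (hn : 1 ≤ n)
    (hN : CMSC.IsProduct (fun i : Fin n => block hpq (r i)) N) : N.IsConnected := by
  obtain ⟨φ, hlab, -, hlink, -, -⟩ := hN
  have hproc : ∀ e f : N.E, N.proc e = N.proc f → (SimpleGraph.fromRel N.le).Reachable e f := by
    intro e f h
    by_cases hef : e = f
    · rw [hef]
    · exact SimpleGraph.Adj.reachable ⟨hef, N.proc_total e f h⟩
  let s : Σ i : Fin n, (block hpq (r i)).E := ⟨⟨0, hn⟩, syncSend⟩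
  let t : Σ i : Fin n, (block hpq (r i)).E := ⟨⟨0, hn⟩, syncRecv⟩
  have hst : N.link (φ s) (φ t) := hlink ⟨0, hn⟩ syncSend syncRecv ⟨rfl, rfl⟩
  have hs : N.proc (φ s) = q := congrArg Act.proc (hlab s)
  have ht : N.proc (φ t) = p := congrArg Act.proc (hlab t)
  have hadj : (SimpleGraph.fromRel N.le).Reachable (φ t) (φ s) := by
    refine SimpleGraph.Adj.reachable ⟨fun h => hpq ?_, .inr ?_⟩
    · exact ht.symm.trans ((congrArg N.proc h).trans hs)
    · exact (N.le_iff _ _).2 (.single (.inr hst))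
  have hall : ∀ e, (SimpleGraph.fromRel N.le).Reachable e (φ s) := by
    intro e
    obtain ⟨x, rfl⟩ := φ.surjective e
    have hx : N.proc (φ x) = (lab hpq x.2).proc := congrArg Act.proc (hlab x)
    obtain ⟨i, _ | _ | j | j⟩ := x
    · exact hproc _ _ (hx.trans hs.symm)
    · exact (hproc _ _ (hx.trans ht.symm)).trans hadj
    · exact hproc _ _ (hx.trans hs.symm)
    · exact (hproc _ _ (hx.trans ht.symm)).trans hadj
  have := N.nonempty
  exact ⟨fun e f => (hall e).trans (hall f).symm⟩

/-- If a product of queue rules contains an MSC, then the rules form a run of the queue system: by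
the first-in-first-out condition, the `a`-th letter appended is the `a`-th letter removed. -/
theorem isQueueRun_of_isProduct (hN : CMSC.IsProduct (fun i : Fin n => block hpq (r i)) N)
    (hM : N.IsMSC) : IsQueueRun r n := by
  obtain ⟨φ, hlab, hle, -, hlink, -⟩ := hN
  let φ' : RunEvent r n → N.E := φ
  have hlab' : ∀ x : RunEvent r n, N.lab (φ' x) = lab hpq x.2 := hlab
  have hle' : ∀ x y : RunEvent r n, (lab hpq x.2).proc = (lab hpq y.2).proc →
      (N.le (φ' x) (φ' y) ↔ RunEvent.key x ≤ RunEvent.key y) := fun x y h =>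
    (hle x y ((congrArg Act.proc (hlab' x)).trans
      (h.trans (congrArg Act.proc (hlab' y)).symm))).trans (RunEvent.lex_iff hpq h)
  have hmatch : ∀ (i : Fin n) (j : Fin (r i).2.length) (i' : Fin n) (j' : Fin (r i').1.length),
      N.link (φ' ⟨i, push j⟩) (φ' ⟨i', pop j'⟩) → i < i' ∧ (r i).2.get j = (r i').1.get j' := by
    intro i j i' j' h
    rcases hlink _ _ h with ⟨i₀, e, f, he, -, ⟨rfl, -⟩⟩ | ⟨hlt, hmu⟩
    · have he : (⟨i, push j⟩ : RunEvent r n) = ⟨i₀, syncSend⟩ := he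
      obtain ⟨rfl, he⟩ := Sigma.mk.inj he
      cases he
    · exact ⟨hlt, Option.some.inj hmu⟩
  have hmatched : ∀ x : RunEvent r n, ∃ y : RunEvent r n,
      N.link (φ' x) (φ' y) ∨ N.link (φ' y) (φ' x) := by
    intro x
    obtain ⟨y, hy⟩ := not_not.1 (hM (φ' x))
    obtain ⟨y, rfl⟩ := φ.surjective y
    exact ⟨y, hy⟩
  have hexPop : ∀ (i : Fin n) (j : Fin (r i).2.length), ∃ (i' : Fin n) (j' : Fin (r i').1.length),
      N.link (φ' ⟨i, push j⟩) (φ' ⟨i', pop j'⟩) := by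
    intro i j
    obtain ⟨⟨i', y⟩, hy⟩ := hmatched ⟨i, push j⟩
    have h1 := hlab' ⟨i, push j⟩
    have h2 : N.lab (φ' ⟨i', y⟩) = lab hpq y := hlab' ⟨i', y⟩
    rcases hy with hy | hy
    · obtain ⟨a, b, hab, ha, hb⟩ := N.link_lab _ _ hy
      obtain ⟨rfl, rfl⟩ := Act.send.inj (h1.symm.trans ha)
      obtain ⟨j', rfl⟩ := exists_pop_of_lab_eq (h2.symm.trans hb)
      exact ⟨i', j', hy⟩
    · obtain ⟨a, b, hab, ha, hb⟩ := N.link_lab _ _ hy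
      cases h1.symm.trans hb
  have hexPush : ∀ (i' : Fin n) (j' : Fin (r i').1.length), ∃ (i : Fin n) (j : Fin (r i).2.length),
      N.link (φ' ⟨i, push j⟩) (φ' ⟨i', pop j'⟩) := by
    intro i' j'
    obtain ⟨⟨i, y⟩, hy⟩ := hmatched ⟨i', pop j'⟩
    have h1 := hlab' ⟨i', pop j'⟩
    have h2 : N.lab (φ' ⟨i, y⟩) = lab hpq y := hlab' ⟨i, y⟩
    rcases hy with hy | hy
    · obtain ⟨a, b, hab, ha, hb⟩ := N.link_lab _ _ hy
      cases h1.symm.trans ha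
    · obtain ⟨a, b, hab, ha, hb⟩ := N.link_lab _ _ hy
      obtain ⟨rfl, rfl⟩ := Act.recv.inj (h1.symm.trans hb)
      obtain ⟨j, rfl⟩ := exists_push_of_lab_eq (h2.symm.trans ha)
      exact ⟨i, j, hy⟩
  -- the matching as a relation between positions in the appended and in the removed word
  let T (a b : ℕ) : Prop := ∃ (i : Fin n) (j : Fin (r i).2.length) (i' : Fin n)
    (j' : Fin (r i').1.length), N.link (φ' ⟨i, push j⟩) (φ' ⟨i', pop j'⟩) ∧
      (catPrefix (fun i => (r i).2) i).length + j = a ∧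
      (catPrefix (fun i => (r i).1) i').length + j' = b
  have hT : ∀ a b, T a b → a < (catPrefix (fun i => (r i).2) n).length ∧
      b < (catPrefix (fun i => (r i).1) n).length := by
    rintro _ _ ⟨i, j, i', j', -, rfl, rfl⟩
    exact ⟨catPrefix_index_lt i.2 j.2, catPrefix_index_lt i'.2 j'.2⟩
  have hA : ∀ a < (catPrefix (fun i => (r i).2) n).length, ∃ b, T a b := by
    intro a ha
    obtain ⟨i, j, hi, hj, rfl⟩ := exists_catPrefix_index ha
    obtain ⟨i', j', h⟩ := hexPop ⟨i, hi⟩ ⟨j, hj⟩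
    exact ⟨_, _, _, _, _, h, rfl, rfl⟩
  have hB : ∀ b < (catPrefix (fun i => (r i).1) n).length, ∃ a, T a b := by
    intro b hb
    obtain ⟨i', j', hi, hj, rfl⟩ := exists_catPrefix_index hb
    obtain ⟨i, j, h⟩ := hexPush ⟨i', hi⟩ ⟨j', hj⟩
    exact ⟨_, _, _, _, _, h, rfl, rfl⟩
  have hmono : ∀ a b a' b', T a b → T a' b' → (a ≤ a' ↔ b ≤ b') := by
    rintro _ _ _ _ ⟨i, j, k, l, h, rfl, rfl⟩ ⟨i', j', k', l', h', rfl, rfl⟩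
    rw [← RunEvent.key_push_le_iff, ← RunEvent.key_pop_le_iff,
      ← hle' ⟨i, push j⟩ ⟨i', push j'⟩ rfl, ← hle' ⟨k, pop l⟩ ⟨k', pop l'⟩ rfl]
    exact N.fifo _ _ _ _ h h'
      (by rw [PreCMSC.proc, PreCMSC.proc, hlab', hlab']; rfl)
      (by rw [PreCMSC.proc, PreCMSC.proc, hlab', hlab']; rfl)
  have hlen := eq_of_monotone_matching_bound hT hA hB hmono
  -- the letter removed at position `b` by rule `i'` has been appended before
  have hpos : ∀ (i' : Fin n) (j' : Fin (r i').1.length),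
      (catPrefix (fun i => (r i).2) i')[(catPrefix (fun i => (r i).1) i').length + j']? =
        some ((r i').1.get j') := by
    intro i' j'
    obtain ⟨i, j, h⟩ := hexPush i' j'
    obtain ⟨hi, hget⟩ := hmatch i j i' j' h
    rw [← eq_of_monotone_matching hT hA hB hmono ⟨i, j, i', j', h, rfl, rfl⟩,
      catPrefix_getElem? (w := fun i => (r i).2) hi j.2, ← hget]
    rfl
  have hprefix : ∀ m ≤ n, ∀ k, m ≤ k + 1 → k ≤ n →
      catPrefix (fun i => (r i).1) m <+: catPrefix (fun i => (r i).2) k := by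
    intro m hm k hmk hk
    rw [List.prefix_iff_getElem?]
    intro b hb
    obtain ⟨i, j, hi, hj, rfl⟩ := exists_catPrefix_index hb
    have h1 := hpos ⟨i, hi.trans_le hm⟩ ⟨j, hj⟩
    obtain ⟨t, ht⟩ := catPrefix_isPrefix (w := fun i => (r i).2) (show i ≤ k by lia)
    have h2 := catPrefix_getElem? (w := fun i => (r i).1) hi hj
    rw [← ht, List.getElem?_append_left (List.getElem?_eq_some_iff.1 h1).1]
    rw [List.getElem?_eq_getElem hb] at h2
    exact h1.trans h2.symm
  exact ⟨fun i hi => hprefix (i + 1) hi i le_rfl hi.le,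
    (hprefix n le_rfl n (by lia) le_rfl).eq_of_length hlen.symm⟩

end Product

/-! ### The HMSC of a queue system -/

section QueueHMSC

variable {P α : Type} [Finite α] {p q : P} (hpq : p ≠ q)
  {R : Set (List α × List α)} (hR : R.Finite) (w : List α)

/-- The HMSC of the queue system `R` with initial content `w`: a transition that appends `w`,
followed by self-loops for the rules. -/
def queueHMSC : HMSC P where
  S := Fin 2
  finite_S := inferInstance
  init := 0
  Msg := α
  finite_Msg := inferInstance
  R := insert (0, block hpq ([], w), 1) ((fun r => (1, block hpq r, 1)) '' R)
  finite_R := (hR.image _).insert _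
  finite_label := by
    have hfin (r : List α × List α) : Finite (block hpq r).E :=
      inferInstanceAs (Finite (BlockEvent r.1.length r.2.length))
    rintro _ (rfl | ⟨r, -, rfl⟩)
    · exact hfin _
    · exact hfin _
  F := {1}
  Fω := ∅

variable {hpq hR w}

/-- The labels of a finite path are queue rules; the path leaves the initial state in its first
step and never returns to it. -/
theorem queueHMSC_exists_rules (ρ : (queueHMSC hpq hR w).FinPath) :
    ∃ r : ℕ → List α × List α, (ρ.label = fun i : Fin ρ.n => block hpq (r i)) ∧
      (∀ i : Fin ρ.n, ρ.state i.castSucc = (0 : Fin 2) → r i = ([], w)) ∧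
      (∀ i : Fin ρ.n, ρ.state i.castSucc = (1 : Fin 2) → r i ∈ R) ∧
      ∀ i : Fin ρ.n, ρ.state i.succ = (1 : Fin 2) := by
  have h : ∀ i : Fin ρ.n, ∃ r : List α × List α, ρ.label i = block hpq r ∧
      (ρ.state i.castSucc = (0 : Fin 2) → r = ([], w)) ∧
      (ρ.state i.castSucc = (1 : Fin 2) → r ∈ R) ∧ ρ.state i.succ = (1 : Fin 2) := by
    intro i
    rcases ρ.step i with h | ⟨r, hr, h⟩
    · obtain ⟨h1, h⟩ := Prod.mk.inj h
      obtain ⟨h2, h3⟩ := Prod.mk.inj h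
      exact ⟨_, h2, fun _ => rfl, fun h' => absurd (h1.symm.trans h') (zero_ne_one (α := Fin 2)), h3⟩
    · obtain ⟨h1, h⟩ := Prod.mk.inj h
      obtain ⟨h2, h3⟩ := Prod.mk.inj h
      exact ⟨r, h2.symm, fun h' => absurd (h1.trans h') (one_ne_zero (α := Fin 2)), fun _ => hr, h3.symm⟩
  choose r hr using h
  let r' : ℕ → List α × List α := fun i => if hi : i < ρ.n then r ⟨i, hi⟩ else ([], [])
  have hr' : ∀ i : Fin ρ.n, r' i = r i := fun i => dif_pos i.2
  refine ⟨r', funext fun i => ?_, fun i => ?_, fun i => ?_, fun i => (hr i).2.2.2⟩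
  · rw [hr', (hr i).1]
  · rw [hr']
    exact (hr i).2.1
  · rw [hr']
    exact (hr i).2.2.1

theorem queueHMSC_loopConnected : (queueHMSC hpq hR w).LoopConnected := by
  intro ρ _ N hN
  obtain ⟨r, hr, -⟩ := queueHMSC_exists_rules ρ
  have hN : CMSC.IsProduct ρ.label N := hN
  rw [hr] at hN
  exact isConnected_of_isProduct ρ.pos hN

theorem queueHMSC_flat : (queueHMSC hpq hR w).Flat := by
  have h : ∀ ρ : (queueHMSC hpq hR w).FinPath, ρ.target = (1 : Fin 2) := by
    intro ρ
    obtain ⟨-, -, -, -, h⟩ := queueHMSC_exists_rules ρ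
    have hlast : Fin.last ρ.n = (⟨ρ.n - 1, by have := ρ.pos; lia⟩ : Fin ρ.n).succ :=
      Fin.ext (by have := ρ.pos; simp; lia)
    rw [HMSC.FinPath.target, hlast]
    exact h _
  rintro s s' ⟨ρ, -, rfl⟩ ⟨ρ', -, rfl⟩
  rw [h, h]

theorem queueHMSC_language_nonempty_iff :
    (queueHMSC hpq hR w).language.Nonempty ↔ QueueReach R w [] := by
  rw [queueReach_nil_iff]
  constructor
  · rintro ⟨N, hM, ⟨ρ, ⟨h0, -⟩, hN⟩ | ⟨ρ, ⟨-, s, hs, -⟩, -⟩⟩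
    · obtain ⟨r, hr, hr0, hr1, hsucc⟩ := queueHMSC_exists_rules ρ
      have hN : CMSC.IsProduct ρ.label N := hN
      rw [hr] at hN
      refine ⟨r, ρ.n, ρ.pos, hr0 ⟨0, ρ.pos⟩ h0, fun i h1 hi => hr1 ⟨i, hi⟩ ?_,
        isQueueRun_of_isProduct hN hM⟩
      have e : (⟨i, hi⟩ : Fin ρ.n).castSucc = (⟨i - 1, by lia⟩ : Fin ρ.n).succ :=
        Fin.ext (by simp; lia)
      rw [e]
      exact hsucc _
    · exact hs.elim
  · rintro ⟨r, n, hn, h0, hR', hrun⟩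
    refine ⟨RunEvent.msc hpq hrun hn, RunEvent.isMSC_msc hpq hrun hn, .inl
      ⟨⟨n, hn, fun i => if i = 0 then (0 : Fin 2) else (1 : Fin 2), fun i => block hpq (r i),
        fun i => ?_⟩, ⟨rfl, ?_⟩, RunEvent.isProduct_msc hpq hrun hn⟩⟩
    · rcases Nat.eq_zero_or_pos i with hi | hi
      · refine .inl ?_
        have hc : i.castSucc = 0 := Fin.ext hi
        simp [hc, hi, h0]
        rfl
      · refine .inr ⟨r i, hR' i hi i.2, ?_⟩
        have hc : i.castSucc ≠ 0 := fun h => hi.ne' (congrArg Fin.val h)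
        simp [hc]
        rfl
    · have hc : Fin.last n ≠ 0 := fun h => by simp [Fin.ext_iff] at h; lia
      exact if_neg hc

end QueueHMSC

/-- The description of `queueHMSC` as finite data, for a list `L` of rules. -/
def queueCode {k : ℕ} {α : Type} (p q : Fin k) (m : ℕ) (τ : α → ℕ) (L : List (List α × List α))
    (w : List α) : HMSCCode k :=
  (2, m, 0, (0, blockCode p q τ ([], w), 1) :: L.map (fun r => (1, blockCode p q τ r, 1)), [1], [])

theorem queueCode_represents {k m : ℕ} {α : Type} [Finite α] {p q : Fin k} (hpq : p ≠ q)
    (τ : α ≃ Fin m) {R : Set (List α × List α)} (hR : R.Finite) {L : List (List α × List α)}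
    (hL : ∀ r, r ∈ L ↔ r ∈ R) (w : List α) :
    (queueCode p q m (fun x => (τ x : ℕ)) L w).Represents (queueHMSC hpq hR w) := by
  refine ⟨Equiv.refl (Fin 2), τ, rfl, ?_, ?_, fun s => ?_, fun s => ?_⟩
  · rintro _ (rfl | ⟨r, hr, rfl⟩)
    · exact ⟨_, List.mem_cons_self, rfl, blockCode_represents hpq τ _, rfl⟩
    · exact ⟨_, List.mem_cons_of_mem _ (List.mem_map_of_mem ((hL r).2 hr)), rfl,
        blockCode_represents hpq τ _, rfl⟩
  · intro u hu
    rcases List.mem_cons.1 hu with rfl | hu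
    · exact ⟨_, Set.mem_insert _ _, rfl, blockCode_represents hpq τ _, rfl⟩
    · obtain ⟨r, hr, rfl⟩ := List.mem_map.1 hu
      exact ⟨_, .inr ⟨r, (hL r).1 hr, rfl⟩, rfl, blockCode_represents hpq τ _, rfl⟩
  · have h (s : Fin 2) : s ∈ ({1} : Set (Fin 2)) ↔ (s : ℕ) ∈ [1] := by
      simp [Fin.ext_iff]
    exact h s
  · have h (s : Fin 2) : s ∈ (∅ : Set (Fin 2)) ↔ (s : ℕ) ∈ ([] : List ℕ) := by simp
    exact h s

theorem primrec_queueCode {k m : ℕ} {α : Type} [Finite α] [Primcodable α] (p q : Fin k)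
    (τ : α → ℕ) (L : List (List α × List α)) {w : ℕ → List α} (hw : Primrec w) :
    Primrec fun n => queueCode p q m τ L (w n) := by
  have hτ : Primrec fun x : α => (((true, p, q), some (τ x)) : (Bool × Fin k × Fin k) × Option ℕ) :=
    Primrec.dom_finite _
  have hmap := Primrec.list_map hw (hτ.comp Primrec.snd).to₂
  have hblock : Primrec fun n => blockCode p q τ ([], w n) :=
    Primrec.pair (Primrec.list_cons.comp (.const _) (Primrec.list_cons.comp (.const _) hmap))
      (.const _)
  exact Primrec.pair (.const _) (Primrec.pair (.const _) (Primrec.pair (.const _) (Primrec.pair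
    (Primrec.list_cons.comp (Primrec.pair (.const _) (Primrec.pair hblock (.const _))) (.const _))
    (.const _))))

theorem not_nonemptinessDecidable {k : ℕ} (hk : 2 ≤ k) (C : HMSC (Fin k) → Prop)
    (hC : ∀ H : HMSC (Fin k), H.LoopConnected → H.Flat → C H) : ¬ NonemptinessDecidable k C := by
  rintro ⟨f, hf, hdec⟩
  obtain ⟨α, _, _, R, w, hR, hw, hund⟩ := exists_undecidable_queue_system
  obtain ⟨m, ⟨τ⟩⟩ := Finite.exists_equiv_fin α
  have hpq : (⟨0, by lia⟩ : Fin k) ≠ ⟨1, by lia⟩ := by simp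
  let c (n : ℕ) : HMSCCode k :=
    queueCode ⟨0, by lia⟩ ⟨1, by lia⟩ m (fun x => (τ x : ℕ)) hR.toFinset.toList (w n)
  have hc : Computable c := (primrec_queueCode _ _ _ _ hw).to_comp
  have key : ∀ n, ∃ b ∈ f (c n), (b = true ↔ QueueReach R (w n) []) := by
    intro n
    obtain ⟨b, hb, hiff⟩ := hdec (c n) (queueHMSC hpq hR (w n))
      (queueCode_represents hpq τ hR (by simp) (w n))
      (hC _ queueHMSC_loopConnected queueHMSC_flat)
    exact ⟨b, hb, hiff.trans queueHMSC_language_nonempty_iff⟩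
  choose b hb hiff using key
  refine hund (ComputablePred.computable_iff.2 ⟨b, ?_, funext fun n => propext (hiff n).symm⟩)
  exact (hf.comp hc).of_eq fun n => Part.eq_some_iff.2 (hb n)

theorem mainTheorem3 :
    (∀ k : ℕ, 2 ≤ k → ¬ NonemptinessDecidable k (fun H => H.LoopConnected)) ∧
    ¬ NonemptinessDecidable 3 (fun H => H.LoopConnected ∧ H.Flat) :=
  ⟨fun _ hk => not_nonemptinessDecidable hk _ fun _ h _ => h,
    not_nonemptinessDecidable (by norm_num) _ fun _ h h' => ⟨h, h'⟩⟩
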